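/- Let $m\ge 1$, $\lambda_1,\dots,\lambda_m>0$ and $\nu_1,\dots,\nu_m\in(0,1)$. Let $H_1,\dots,H_m$ be independent stable subordinators, $H_j$ of order $\nu_j$: $H_j(0)=0$ a.s., $H_j$ has stationary independent increments and a.s. nondecreasing right-continuous paths, and $\mathbb E e^{-\mu H_j(t)}=e^{-t\mu^{\nu_j}}$ for $\mu>0$, $t\ge0$. Put $$H(t)=\sum_{j=1}^m\lambda_j^{1/\nu_j}H_j(t)\quad(t\ge 0),\qquad L(t)=\inf\{s>0: H(s)\ge t\}\quad(t>0).$$ For $\nu\in(0,1)$ and $x>0$ let $$I^{1-\nu}f(x)=\frac1{\Gamma(1-\nu)}\int_0^x\frac{f(s)}{(x-s)^\nu}\,ds,\qquad \frac{d^\nu f}{dx^\nu}(x)=\frac{d}{dx}I^{1-\nu}f(x)$$ denote the fractional integral and the Riemann–Liouville derivative with base point $0$. (i) For every $t>0$ the law of $H(t)$ is concentrated on $(0,\infty)$ and has a density $h(\cdot,t)\ge 0$ there. The function $h$ satisfies, pointwise, $$\partial_t h(x,t)=-\sum_{j=1}^m\lambda_j\,\partial_x^{\nu_j}h(x,t)\quad(x>0,\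 t>0),$$ where all the derivatives exist, with $h(x,0)=\delta(x)$, meaning that $\int_0^\infty\varphi(x)h(x,t)\,dx\to\varphi(0)$ as $t\to0^+$ for every bounded continuous $\varphi$, and $h(0,t)=0$, with $h(\cdot,t)$ continuous on $[0,\infty)$. It is the unique solution $u$ of this problem on $[0,\infty)\times(0,\infty)$ such that, for every $t>0$, $u(\cdot,t)$ is continuous on $[0,\infty)$ and integrable on $(0,\infty)$, and such that, for all $\mu,t>0$, $e^{-\mu x}\partial_t u(x,t)$ is integrable in $x\in(0,\infty)$ and $\partial_t\int_0^\infty e^{-\mu x}u(x,t)\,dx=\int_0^\infty e^{-\mu x}\partial_tu(x,t)\,dx$; in particular $h$ has these properties. Its Fourier transform is $$\int_0^\infty e^{i\xi x}h(x,t)\,dx=e^{-t\sum_{j=1}^m\lambda_j(-i\xi)^{\nu_j}}\qquad(\xi\in\mathbb R,\ t>0),$$ with the principal branch of the powers. (ii) For every $t>0$ the law of $L(t)$ is concentrated on $(0,\infty)$ and has a density $l(\cdot,t)\ge 0$ there. The function $l$ satisfies, pointwise, $$\sum_{j=1}^m\lambda_j\,\partial_t^{\nu_j}l(x,t)=-\partial_xl(x,t)\quad(x>0,\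 t>0),$$ where all the derivatives exist, and $$l(0,t)=\lim_{x\to0^+}l(x,t)=\sum_{j=1}^m\lambda_j\frac{t^{-\nu_j}}{\Gamma(1-\nu_j)}\quad(t>0).$$ It is the unique solution $u$ of this problem on $[0,\infty)\times(0,\infty)$ such that, for every $x>0$, $u(x,\cdot)$ is continuous on $(0,\infty)$ and $I^{1-\nu_j}u(x,\cdot)(t)\to0$ as $t\to0^+$ for each $j$, and such that, for all $x,\mu>0$, $e^{-\mu t}u(x,t)$ and $e^{-\mu t}\partial_xu(x,t)$ are integrable in $t\in(0,\infty)$, $\partial_x\int_0^\infty e^{-\mu t}u(x,t)\,dt=\int_0^\infty e^{-\mu t}\partial_xu(x,t)\,dt$, and $\int_0^\infty e^{-\mu t}u(x,t)\,dt\to\int_0^\infty e^{-\mu t}u(0,t)\,dt$ as $x\to0^+$; in particular $l$ has these properties. Its double Laplace transform is $$\int_0^\infty e^{-\mu t}\int_0^\infty e^{-\gamma x}l(x,t)\,dx\,dt=\frac{\sum_{j=1}^m\lambda_j\mu^{\nu_j-1}}{\sum_{j=1}^m\lambda_j\mu^{\nu_j}+\gamma}\qquad(\gamma,\mu>0).$$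 -/

import Mathlib

open MeasureTheory ProbabilityTheory Filter Topology Set
open scoped NNReal BoundedContinuousFunction

/-- The stable subordinator of order `ν`, normalised by `E exp (-μ H(t)) = exp (-t μ ^ ν)`: it
starts at `0`, has independent stationary increments, and almost every path is nondecreasing
and right-continuous (left limits exist by monotonicity). -/
structure IsStableSubordinator {Ω : Type*} [MeasurableSpace Ω] (P : Measure Ω) (ν : ℝ)
    (H : ℝ≥0 → Ω → ℝ) : Prop where
  measurable : ∀ t, Measurable (H t)
  zero : ∀ᵐ ω ∂P, H 0 ω = 0
  indep_increments : HasIndepIncrements H P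
  stationary_increments : ∀ s t, IdentDistrib (fun ω => H (s + t) ω - H s ω) (H t) P P
  paths : ∀ᵐ ω ∂P, Monotone (fun t => H t ω) ∧
    ∀ t, ContinuousWithinAt (fun s => H s ω) (Ici t) t
  laplace : ∀ t : ℝ≥0, ∀ μ : ℝ, 0 < μ →
    ∫ ω, Real.exp (-μ * H t ω) ∂P = Real.exp (-(t : ℝ) * μ ^ ν)

/-- The process `∑ j, λ_j ^ (1 / ν_j) H_j(t)`. -/
noncomputable def weightedSum {Ω : Type*} {m : ℕ} (lam ν : Fin m → ℝ)
    (H : Fin m → ℝ≥0 → Ω → ℝ) (t : ℝ≥0) (ω : Ω) : ℝ :=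
  ∑ j, lam j ^ (1 / ν j) * H j t ω

/-- The inverse process `inf {s > 0 : X(s) ≥ t}`. -/
noncomputable def hittingTime {Ω : Type*} (X : ℝ≥0 → Ω → ℝ) (t : ℝ) (ω : Ω) : ℝ :=
  sInf {s : ℝ | 0 < s ∧ t ≤ X s.toNNReal ω}

/-- The law of `X` has the (nonnegative) density `f` on the half-line `(0, ∞)`, and puts no mass
elsewhere. -/
def HasHalfLineDensity {Ω : Type*} [MeasurableSpace Ω] (P : Measure Ω) (X : Ω → ℝ)
    (f : ℝ → ℝ) : Prop :=
  AEMeasurable X P ∧ (∀ x, 0 < x → 0 ≤ f x) ∧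
    P.map X = (volume.restrict (Ioi 0)).withDensity (fun x => ENNReal.ofReal (f x))

/-- The fractional integral `(1 / Γ(1 - ν)) ∫_0^x f(s) / (x - s) ^ ν ds`, of order `1 - ν`. -/
noncomputable def fracIntegral (ν : ℝ) (f : ℝ → ℝ) (x : ℝ) : ℝ :=
  1 / Real.Gamma (1 - ν) * ∫ s in (0 : ℝ)..x, f s / (x - s) ^ ν

/-- For `0 < ν < 1`, the Riemann-Liouville derivative of order `ν` of `f` at `x > 0` exists and
equals `d`: the integrals defining the fractional integral converge near `x`, and the fractional
integral is differentiable at `x` with derivative `d`. -/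
def HasRLDerivAt (ν : ℝ) (f : ℝ → ℝ) (d x : ℝ) : Prop :=
  (∀ᶠ y in 𝓝 x, IntervalIntegrable (fun s => f s / (y - s) ^ ν) volume 0 y) ∧
    HasDerivAt (fracIntegral ν f) d x

/-- `u (x, t)` solves `∂_t u = - ∑ λ_j ∂_x ^ {ν_j} u` for `x, t > 0`, with `u (x, 0) = δ(x)` and
`u (0, t) = 0`, in the class of functions for which the Laplace transform in `x`
commutes with `∂_t`. -/
structure SolvesDensityProblem {m : ℕ} (lam ν : Fin m → ℝ) (u : ℝ → ℝ → ℝ) : Prop where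
  continuousOn : ∀ t, 0 < t → ContinuousOn (fun x => u x t) (Ici 0)
  integrableOn : ∀ t, 0 < t → IntegrableOn (fun x => u x t) (Ioi 0)
  equation : ∀ x t, 0 < x → 0 < t → ∃ d : Fin m → ℝ,
    (∀ j, HasRLDerivAt (ν j) (fun y => u y t) (d j) x) ∧
      HasDerivAt (fun s => u x s) (-∑ j, lam j * d j) t
  initial : ∀ φ : ℝ →ᵇ ℝ,
    Tendsto (fun t => ∫ x in Ioi (0 : ℝ), φ x * u x t) (𝓝[>] 0) (𝓝 (φ 0))
  boundary : ∀ t, 0 < t → u 0 t = 0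
  laplace_integrable : ∀ t μ, 0 < t → 0 < μ →
    IntegrableOn (fun x => Real.exp (-μ * x) * deriv (fun s => u x s) t) (Ioi 0)
  laplace_deriv : ∀ t μ, 0 < t → 0 < μ →
    HasDerivAt (fun s => ∫ x in Ioi (0 : ℝ), Real.exp (-μ * x) * u x s)
      (∫ x in Ioi (0 : ℝ), Real.exp (-μ * x) * deriv (fun s => u x s) t) t

/-- `u (x, t)` solves `∑ λ_j ∂_t ^ {ν_j} u = - ∂_x u` for `x, t > 0`, with
`u (0, t) = ∑ λ_j t ^ {-ν_j} / Γ(1 - ν_j)`, in the class of functions whose fractional integrals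
in `t` vanish at `t = 0` (so that the Laplace transform of `∂_t ^ {ν_j} u` has no initial term) and
for which the Laplace transform in `t` commutes with `∂_x` and with `x → 0`. -/
structure SolvesInverseProblem {m : ℕ} (lam ν : Fin m → ℝ) (u : ℝ → ℝ → ℝ) : Prop where
  continuousOn : ∀ x, 0 < x → ContinuousOn (fun t => u x t) (Ioi 0)
  equation : ∀ x t, 0 < x → 0 < t → ∃ d : Fin m → ℝ,
    (∀ j, HasRLDerivAt (ν j) (fun s => u x s) (d j) t) ∧
      HasDerivAt (fun y => u y t) (-∑ j, lam j * d j) x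
  boundary : ∀ t, 0 < t → u 0 t = ∑ j, lam j * (t ^ (-ν j) / Real.Gamma (1 - ν j))
  boundary_tendsto : ∀ t, 0 < t → Tendsto (fun x => u x t) (𝓝[>] 0) (𝓝 (u 0 t))
  fracIntegral_zero : ∀ x, 0 < x → ∀ j,
    Tendsto (fracIntegral (ν j) (fun s => u x s)) (𝓝[>] 0) (𝓝 0)
  laplace_integrable : ∀ x μ, 0 < x → 0 < μ →
    IntegrableOn (fun t => Real.exp (-μ * t) * u x t) (Ioi 0) ∧
      IntegrableOn (fun t => Real.exp (-μ * t) * deriv (fun y => u y t) x) (Ioi 0)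
  laplace_deriv : ∀ x μ, 0 < x → 0 < μ →
    HasDerivAt (fun y => ∫ t in Ioi (0 : ℝ), Real.exp (-μ * t) * u y t)
      (∫ t in Ioi (0 : ℝ), Real.exp (-μ * t) * deriv (fun y => u y t) x) x
  laplace_boundary : ∀ μ, 0 < μ →
    Tendsto (fun x => ∫ t in Ioi (0 : ℝ), Real.exp (-μ * t) * u x t) (𝓝[>] 0)
      (𝓝 (∫ t in Ioi (0 : ℝ), Real.exp (-μ * t) * u 0 t))

/-!
Write `Ψ(z) = ∑ j, λ_j z ^ ν_j` for the Laplace exponent of the weighted sum. By independence the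
law of `H(t)` has Laplace transform `e^{-tΨ(μ)}`, which extends to `Re z > 0` by the identity
theorem (`IsSubordinatorLaw.laplace_complex`). Since `Re Ψ(z)` dominates a positive multiple of
`|z| ^ ν_j`, the function `g(z) e^{-tΨ(z)}` is integrable over each vertical line for every `g` of
polynomial growth, and all functions of interest are Bromwich integrals (`bromwich`) of such
functions: the density `h` has symbol `g = 1`, by Fourier inversion for the tilted measure
(`IsSubordinatorLaw.density`), and `l` has symbol `Ψ(z) / z`, with the roles of `x` and `t`
exchanged. On symbols, `∂_t` is multiplication by `-Ψ` (`hasDerivAt_bromwich_time`), and the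
Riemann–Liouville derivative of order `a` is multiplication by `z ^ a` (`hasRLDerivAt_bromwich`).
The latter holds because the integral vanishes on the negative half-line, where `h` has no mass, so
that fractional integrals with base points `0` and `-∞` agree. Both equations then reduce to the
definition of `Ψ`.

Boundary values come from `l(x, ·) = ∑ j, λ_j I ^ {1 - ν_j} h(·, x)` and the weak convergence of the
laws to `δ_0`. Weak convergence does not control the kernel of the fractional integral at its
singularity; this is supplied by `h(y, x) = O(x)` for `y` away from `0`, obtained by two
integrations by parts along the vertical line (`exists_sq_mul_norm_bromwich_le`).

The first-passage time satisfies `L(t) ≤ x` if and only if `H(x) ≥ t`, almost surely, and the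
probability of the latter event is `1 - ∫_0^t h(y, x) dy`, whose `x`-derivative is `l(x, t)`.

For uniqueness, Laplace transformation turns either problem into `A' = -Ψ(μ) A` with known initial
value, and a continuous function with vanishing Laplace transform is zero
(`eq_zero_of_laplace_eq_zero`).
-/

/-! ### Laplace and Fourier inversion -/

/-- The identity theorem: holomorphic functions on the right half-plane that agree on the positive
reals agree. -/
theorem eqOn_re_pos_of_eq_ofReal {F G : ℂ → ℂ} (hF : DifferentiableOn ℂ F {z | 0 < z.re})
    (hG : DifferentiableOn ℂ G {z | 0 < z.re}) (h : ∀ μ : ℝ, 0 < μ → F μ = G μ) {z : ℂ}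
    (hz : 0 < z.re) : F z = G z := by
  have ho : IsOpen {z : ℂ | 0 < z.re} := isOpen_lt continuous_const Complex.continuous_re
  refine (hF.analyticOnNhd ho).eqOn_of_preconnected_of_frequently_eq (hG.analyticOnNhd ho)
    (convex_halfSpace_re_gt 0).isPreconnected (z₀ := 1) (by simp) ?_ hz
  have ht : Tendsto (fun x : ℝ => (x : ℂ)) (𝓝[≠] 1) (𝓝[≠] 1) := by
    refine tendsto_nhdsWithin_iff.2 ⟨?_, ?_⟩
    · exact (Complex.continuous_ofReal.tendsto' 1 1 (by simp)).mono_left nhdsWithin_le_nhds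
    · filter_upwards [self_mem_nhdsWithin] with x hx
      simpa using hx
  refine ht.frequently ?_
  refine Eventually.frequently ?_
  filter_upwards [nhdsWithin_le_nhds (Ioi_mem_nhds (zero_lt_one' ℝ))] with x hx using h x hx

theorem differentiableOn_laplace {ρ : Measure ℝ} {f : ℝ → ℂ} (hsupp : ∀ᵐ x ∂ρ, 0 ≤ x)
    (hf : ∀ μ : ℝ, 0 < μ → Integrable (fun x => (Real.exp (-μ * x) : ℂ) * f x) ρ) :
    DifferentiableOn ℂ (fun z => ∫ x, Complex.exp (-z * x) * f x ∂ρ) {z | 0 < z.re} := by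
  intro z hz
  have hz : 0 < z.re := hz
  have hm : AEStronglyMeasurable f ρ := by
    have h1 := (hf 1 one_pos).aestronglyMeasurable
    have h2 : AEStronglyMeasurable (fun x : ℝ => (Real.exp x : ℂ)) ρ := by fun_prop
    refine (h2.mul h1).congr (Eventually.of_forall fun x => ?_)
    simp only [Pi.mul_apply]
    rw [← mul_assoc, ← Complex.ofReal_mul, ← Real.exp_add]
    simp
  have hs : {w : ℂ | z.re / 2 < w.re} ∈ 𝓝 z :=
    (isOpen_lt continuous_const Complex.continuous_re).mem_nhds (by simp; linarith)
  refine (hasDerivAt_integral_of_dominated_loc_of_deriv_le (μ := ρ)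
    (F := fun z x => Complex.exp (-z * x) * f x)
    (F' := fun z x => Complex.exp (-z * x) * (-1 * x) * f x)
    (bound := fun x => 4 / z.re * ‖(Real.exp (-(z.re / 4) * x) : ℂ) * f x‖)
    hs ?_ ?_ ?_ ?_ ?_ ?_).2.differentiableAt.differentiableWithinAt
  · exact Eventually.of_forall fun w => by fun_prop
  · refine (hf z.re hz).mono (by fun_prop) (Eventually.of_forall fun x => ?_)
    simp [Complex.norm_exp]
  · fun_prop
  · filter_upwards [hsupp] with x hx w hw
    have hw : z.re / 2 < w.re := hw
    rw [norm_mul, norm_mul (Complex.exp _), norm_mul (Complex.ofReal _), ← mul_assoc]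
    refine mul_le_mul_of_nonneg_right ?_ (norm_nonneg _)
    rw [Complex.norm_exp, Complex.norm_real, Real.norm_of_nonneg (Real.exp_nonneg _)]
    have e1 : ‖(-1 : ℂ) * (x : ℂ)‖ = x := by simp [abs_of_nonneg hx]
    have e2 : (-w * x).re = -(w.re * x) := by simp
    rw [e1, e2]
    have h1 : z.re / 4 * x ≤ Real.exp (z.re / 4 * x) := by
      linarith [Real.add_one_le_exp (z.re / 4 * x)]
    have h2 : x ≤ 4 / z.re * Real.exp (z.re / 4 * x) := by
      rw [div_mul_eq_mul_div, le_div_iff₀ hz]; linarith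
    calc Real.exp (-(w.re * x)) * x
        ≤ Real.exp (-(z.re / 2 * x)) * (4 / z.re * Real.exp (z.re / 4 * x)) := by gcongr
      _ = 4 / z.re * Real.exp (-(z.re / 4) * x) := by
        rw [mul_left_comm, ← Real.exp_add]; ring_nf
  · exact (hf _ (by positivity)).norm.const_mul _
  · refine Eventually.of_forall fun x w _ => ?_
    have h1 : HasDerivAt (fun w : ℂ => -w * x) (-1 * x) w := (hasDerivAt_id w).neg.mul_const _
    exact h1.cexp.mul_const _

open scoped FourierTransform in
/-- Uniqueness for the Laplace transform. The transform is holomorphic on `Re z > 0`, so it vanishes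
there; on `Re z = 1` it is the Fourier transform of `e^{-x} f(x)`, and inversion applies. -/
theorem eq_zero_of_laplace_eq_zero {f : ℝ → ℝ} (hc : ContinuousOn f (Ioi 0))
    (hi : ∀ μ, 0 < μ → IntegrableOn (fun x => Real.exp (-μ * x) * f x) (Ioi 0))
    (h0 : ∀ μ, 0 < μ → ∫ x in Ioi (0 : ℝ), Real.exp (-μ * x) * f x = 0) {x : ℝ} (hx : 0 < x) :
    f x = 0 := by
  have hic : ∀ μ : ℝ, 0 < μ → Integrable (fun x => (Real.exp (-μ * x) : ℂ) * (f x : ℂ))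
      (volume.restrict (Ioi 0)) := fun μ hμ => by
    simpa using (hi μ hμ).ofReal (𝕜 := ℂ)
  have hD := differentiableOn_laplace (ρ := volume.restrict (Ioi 0)) (f := fun x => (f x : ℂ))
    ((ae_restrict_mem measurableSet_Ioi).mono fun x hx => le_of_lt hx) hic
  have hL : ∀ z : ℂ, 0 < z.re → ∫ x in Ioi (0 : ℝ), Complex.exp (-z * x) * (f x : ℂ) = 0 := by
    intro z hz
    refine eqOn_re_pos_of_eq_ofReal hD (differentiableOn_const (0 : ℂ)) (fun μ hμ => ?_) hz
    have := h0 μ hμ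
    rw [← Complex.ofReal_inj, ← integral_complex_ofReal] at this
    simpa using this
  set g : ℝ → ℂ := (Ioi (0 : ℝ)).indicator fun x => (Real.exp (-1 * x) : ℂ) * (f x : ℂ) with hg
  have hgi : Integrable g := (integrable_indicator_iff measurableSet_Ioi).2 (hic 1 one_pos)
  have hF : 𝓕 g = 0 := by
    ext w
    rw [Real.fourier_real_eq_integral_exp_smul, Pi.zero_apply,
      ← hL (1 + 2 * Real.pi * w * Complex.I) (by simp), ← integral_indicator measurableSet_Ioi]
    congr 1 with v
    by_cases hv : v ∈ Ioi (0 : ℝ)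
    · simp only [hg, indicator_of_mem hv, smul_eq_mul]
      rw [Complex.ofReal_exp, ← mul_assoc, ← Complex.exp_add]
      congr 2
      push_cast
      ring
    · simp [hg, indicator_of_notMem hv]
  have hgc : ContinuousAt g x := by
    have h1 : ContinuousAt (fun x : ℝ => (Real.exp (-1 * x) : ℂ) * (f x : ℂ)) x := by
      have : ContinuousAt f x := hc.continuousAt (Ioi_mem_nhds hx)
      fun_prop
    refine h1.congr ?_
    filter_upwards [Ioi_mem_nhds hx] with y hy
    simp [hg, indicator_of_mem hy]
  have key := hgi.fourierInv_fourier_eq (by rw [hF]; exact integrable_zero _ _ _) hgc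
  rw [hF, Real.fourierInv_eq] at key
  have hx' : x ∈ Ioi (0 : ℝ) := hx
  simpa [hg, indicator_of_mem hx', eq_comm] using key

/-- Fubini for the Gaussian mollification of a characteristic function: the regularised inverse
Fourier integral is the convolution of the measure with a Gaussian. -/
theorem integral_gaussian_mul_charFun {ρ : Measure ℝ} [IsFiniteMeasure ρ] {ψ : ℝ → ℂ}
    (hψ : ∀ w, ψ w = ∫ u, Complex.exp (-(2 * Real.pi * w * u) * Complex.I) ∂ρ) {b : ℝ} (hb : 0 < b)
    (x : ℝ) :
    ∫ w : ℝ, Complex.exp (-b * w ^ 2) * (Complex.exp (2 * Real.pi * w * x * Complex.I) * ψ w) =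
      ((∫ u, Real.sqrt (Real.pi / b) *
        Real.exp (-(Real.pi ^ 2 / b) * (x - u) ^ 2) ∂ρ : ℝ) : ℂ) := by
  have hg : Integrable (fun w : ℝ => Complex.exp (-b * w ^ 2)) := by
    have := integrable_cexp_quadratic (b := b) (by simpa using hb) 0 0
    simpa using this
  have hprod : Integrable (Function.uncurry fun (w u : ℝ) =>
      Complex.exp (-b * w ^ 2) * Complex.exp (2 * Real.pi * w * (x - u) * Complex.I))
      (volume.prod ρ) := by
    refine (hg.mul_prod (integrable_const (1 : ℂ)) (ν := ρ)).mono (by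
      refine Continuous.aestronglyMeasurable ?_
      unfold Function.uncurry
      fun_prop) (Eventually.of_forall fun p => ?_)
    rcases p with ⟨w, u⟩
    simp [Function.uncurry, Complex.norm_exp]
  calc _ = ∫ w : ℝ, ∫ u, Complex.exp (-b * w ^ 2) *
        Complex.exp (2 * Real.pi * w * (x - u) * Complex.I) ∂ρ := by
        congr 1 with w
        rw [hψ, ← integral_const_mul, ← integral_const_mul]
        congr 1 with u
        rw [← Complex.exp_add]
        congr 3
        ring
    _ = ∫ u : ℝ, (∫ w : ℝ, Complex.exp (-b * w ^ 2) *
        Complex.exp (2 * Real.pi * w * (x - u) * Complex.I)) ∂ρ := integral_integral_swap hprod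
    _ = _ := by
        rw [← integral_complex_ofReal]
        congr 1 with u
        have := fourierIntegral_gaussian (b := b) (by simpa using hb) (2 * Real.pi * (x - u))
        refine Eq.trans (integral_congr_ae (Eventually.of_forall fun w => ?_)) (this.trans ?_)
        · simp only
          rw [mul_comm]
          congr 2
          ring
        · rw [Real.sqrt_eq_rpow, Complex.ofReal_mul, Complex.ofReal_cpow (by positivity)]
          push_cast
          congr 2
          have : (b : ℂ) ≠ 0 := by exact_mod_cast hb.ne'
          field_simp
          ring

open scoped FourierTransform in
/-- Fourier inversion for a finite measure with integrable Fourier transform `ψ`: the measure is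
absolutely continuous, with the nonnegative function `𝓕⁻ ψ` as density. -/
theorem fourierInv_density {ρ : Measure ℝ} [IsFiniteMeasure ρ] {ψ : ℝ → ℂ}
    (hψ : ∀ w, ψ w = ∫ u, Complex.exp (-(2 * Real.pi * w * u) * Complex.I) ∂ρ)
    (hc : Continuous ψ) (hi : Integrable ψ) :
    (∀ x, 0 ≤ (𝓕⁻ ψ x).re) ∧
      ρ = volume.withDensity fun x => ENNReal.ofReal (𝓕⁻ ψ x).re := by
  -- the densities of the convolutions of `ρ` with Gaussians; they converge pointwise to `𝓕⁻ ψ`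
  set p : ℕ → ℝ → ℝ := fun n x => ∫ u, Real.sqrt (Real.pi / (1 / (n + 1 : ℝ))) *
    Real.exp (-(Real.pi ^ 2 / (1 / (n + 1 : ℝ))) * (x - u) ^ 2) ∂ρ with hp
  have hb : ∀ n : ℕ, (0 : ℝ) < 1 / (n + 1 : ℝ) := fun n => by positivity
  have hp0 : ∀ n x, 0 ≤ p n x := fun n x => integral_nonneg fun u => by positivity
  have hlim : ∀ x, Tendsto (fun n => (p n x : ℂ)) atTop (𝓝 (𝓕⁻ ψ x)) := by
    intro x
    have h1 : Integrable fun w : ℝ => Complex.exp (2 * Real.pi * w * x * Complex.I) * ψ w := by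
      refine hi.mono (by fun_prop) (Eventually.of_forall fun w => ?_)
      simp [Complex.norm_exp]
    have h2 := (Real.tendsto_integral_cexp_sq_smul h1).comp
      (tendsto_natCast_atTop_atTop.atTop_add (tendsto_const_nhds (x := (1 : ℝ))) :
        Tendsto (fun n : ℕ => (n : ℝ) + 1) atTop atTop)
    rw [Real.fourierInv_eq']
    convert h2 using 1
    · ext n
      rw [hp, ← integral_gaussian_mul_charFun hψ (hb n) x]
      have h4 : ∀ w : ℝ, ((|w| : ℝ) : ℂ) ^ 2 = (w : ℂ) ^ 2 := fun w => by
        rw [← Complex.ofReal_pow, sq_abs, Complex.ofReal_pow]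
      simp [h4]
    · congr 2 with w
      simp
      left; congr 1; ring
  have hre : ∀ x, Tendsto (fun n => p n x) atTop (𝓝 (𝓕⁻ ψ x).re) := fun x =>
    (Complex.continuous_re.tendsto _).comp (hlim x)
  have hnn : ∀ x, 0 ≤ (𝓕⁻ ψ x).re := fun x => ge_of_tendsto' (hre x) fun n => hp0 n x
  have him : ∀ x, ((𝓕⁻ ψ x).re : ℂ) = 𝓕⁻ ψ x := fun x => by
    have h3 : Tendsto (fun n => (p n x : ℂ)) atTop (𝓝 ((𝓕⁻ ψ x).re : ℂ)) :=
      (Complex.continuous_ofReal.tendsto _).comp (hre x)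
    exact tendsto_nhds_unique h3 (hlim x)
  refine ⟨hnn, ?_⟩
  have hcont : Continuous (𝓕⁻ ψ) := by
    have : Continuous (𝓕 fun x => ψ (-x)) :=
      VectorFourier.fourierIntegral_continuous Real.continuous_fourierChar
        (L := innerₗ ℝ) continuous_inner hi.comp_neg
    rwa [← Real.fourierInv_eq_fourier_comp_neg] at this
  have hmeas : ∀ n, Measurable fun x => ENNReal.ofReal (p n x) := by
    intro n
    have : StronglyMeasurable (p n) := by
      refine StronglyMeasurable.integral_prod_right (f := fun x u =>
        Real.sqrt (Real.pi / (1 / (n + 1 : ℝ))) *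
          Real.exp (-(Real.pi ^ 2 / (1 / (n + 1 : ℝ))) * (x - u) ^ 2)) ?_
      refine Continuous.stronglyMeasurable ?_
      unfold Function.uncurry
      fun_prop
    exact this.measurable.ennreal_ofReal
  have hmass : ∀ n, ∫⁻ x, ENNReal.ofReal (p n x) = ρ univ := by
    intro n
    set b : ℝ := 1 / (n + 1 : ℝ)
    have hb : 0 < b := hb n
    have h1 : ∀ x, ENNReal.ofReal (p n x) = ∫⁻ u, ENNReal.ofReal (Real.sqrt (Real.pi / b) *
        Real.exp (-(Real.pi ^ 2 / b) * (x - u) ^ 2)) ∂ρ := by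
      intro x
      refine ofReal_integral_eq_lintegral_ofReal ?_ (Eventually.of_forall fun u => by positivity)
      refine (integrable_const (Real.sqrt (Real.pi / b))).mono (by fun_prop)
        (Eventually.of_forall fun u => ?_)
      rw [Real.norm_of_nonneg (by positivity), Real.norm_of_nonneg (by positivity)]
      refine mul_le_of_le_one_right (by positivity) ?_
      rw [Real.exp_le_one_iff]
      rw [neg_mul]
      exact neg_nonpos.2 (by positivity)
    have h2 : ∀ u : ℝ, ∫⁻ x, ENNReal.ofReal (Real.sqrt (Real.pi / b) *
        Real.exp (-(Real.pi ^ 2 / b) * (x - u) ^ 2)) = 1 := by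
      intro u
      rw [lintegral_sub_right_eq_self (fun y => ENNReal.ofReal (Real.sqrt (Real.pi / b) *
        Real.exp (-(Real.pi ^ 2 / b) * y ^ 2))) u, ← ofReal_integral_eq_lintegral_ofReal
          ((integrable_exp_neg_mul_sq (by positivity)).const_mul _)
          (Eventually.of_forall fun u => by positivity), integral_const_mul, integral_gaussian,
        ← Real.sqrt_mul (by positivity)]
      have : Real.pi / b * (Real.pi / (Real.pi ^ 2 / b)) = 1 := by
        have := Real.pi_ne_zero
        field_simp
      simp [this]
    simp_rw [h1]
    rw [lintegral_lintegral_swap (by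
      refine Measurable.aemeasurable ?_
      refine Measurable.ennreal_ofReal (Continuous.measurable ?_)
      fun_prop)]
    simp only [h2, lintegral_const, one_mul]
  -- Fatou's lemma
  have hle : ∫⁻ x, ENNReal.ofReal (𝓕⁻ ψ x).re ≤ ρ univ := by
    calc _ = ∫⁻ x, liminf (fun n => ENNReal.ofReal (p n x)) atTop := by
          congr 1 with x
          exact (((ENNReal.continuous_ofReal.tendsto _).comp (hre x)).liminf_eq).symm
      _ ≤ liminf (fun n => ∫⁻ x, ENNReal.ofReal (p n x)) atTop := lintegral_liminf_le hmeas
      _ = ρ univ := by simp [hmass]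
  have hint : Integrable (𝓕⁻ ψ) := by
    refine ⟨hcont.aestronglyMeasurable, ?_⟩
    refine lt_of_le_of_lt (le_of_eq ?_) (hle.trans_lt (measure_lt_top ρ univ))
    congr 1 with x
    rw [← him x, ← ofReal_norm, Complex.norm_real, Real.norm_of_nonneg (by simpa using hnn x)]
    simp
  have hfin : IsFiniteMeasure (volume.withDensity fun x => ENNReal.ofReal (𝓕⁻ ψ x).re) :=
    isFiniteMeasure_withDensity (hle.trans_lt (measure_lt_top ρ univ)).ne
  have hFψ : Integrable (𝓕 ψ) := by
    have := hint.comp_neg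
    refine this.congr (Eventually.of_forall fun x => ?_)
    simp [Real.fourierInv_eq_fourier_neg]
  have hinv := hc.fourier_fourierInv_eq hi hFψ
  refine Measure.ext_of_charFun (funext fun t => ?_)
  have e1 : charFun ρ t = ψ (-(t / (2 * Real.pi))) := by
    rw [charFun_apply_real, hψ]
    congr 1 with u
    congr 1
    push_cast
    have : (Real.pi : ℂ) ≠ 0 := by exact_mod_cast Real.pi_ne_zero
    field_simp
  have hm : Measurable fun x => ENNReal.ofReal (𝓕⁻ ψ x).re :=
    (Complex.continuous_re.comp hcont).measurable.ennreal_ofReal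
  rw [e1, charFun_apply_real, ← congrFun hinv, Real.fourier_real_eq_integral_exp_smul,
    integral_withDensity_eq_integral_toReal_smul hm (by simp)]
  congr 1 with u
  rw [ENNReal.toReal_ofReal (hnn u), Complex.real_smul, him, smul_eq_mul, mul_comm]
  congr 2
  push_cast
  have : (Real.pi : ℂ) ≠ 0 := by exact_mod_cast Real.pi_ne_zero
  field_simp

/-! ### Laplace transforms of fractional integrals and derivatives -/

theorem integrableOn_exp_mul_rpow_neg {ν μ : ℝ} (hν : ν < 1) (hμ : 0 < μ) :
    IntegrableOn (fun r => Real.exp (-μ * r) * r ^ (-ν)) (Ioi 0) := by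
  have := integrableOn_rpow_mul_exp_neg_mul_rpow (p := 1) (s := -ν) (by linarith) one_pos hμ
  simpa [mul_comm] using this

theorem integral_exp_mul_rpow_neg {ν μ : ℝ} (hν : ν < 1) (hμ : 0 < μ) :
    ∫ r in Ioi (0 : ℝ), Real.exp (-μ * r) * (r ^ (-ν) / Real.Gamma (1 - ν)) = μ ^ (ν - 1) := by
  have h := Real.integral_rpow_mul_exp_neg_mul_Ioi (a := 1 - ν) (by linarith) hμ
  have hG : Real.Gamma (1 - ν) ≠ 0 := (Real.Gamma_pos_of_pos (by linarith)).ne'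
  rw [one_div, Real.inv_rpow hμ.le, ← Real.rpow_neg hμ.le, neg_sub] at h
  rw [eq_comm, ← mul_div_cancel_right₀ (μ ^ (ν - 1)) hG, ← h, ← integral_div]
  congr 1 with r
  rw [show 1 - ν - 1 = -ν by ring, neg_mul]
  ring

/-- The fractional integral is a convolution on the half-line with `r ^ (-ν) / Γ(1 - ν)`, whose
Laplace transform is `μ ^ (ν - 1)`. -/
theorem laplace_fracIntegral {ν μ : ℝ} (hν : ν < 1) (hμ : 0 < μ) {f : ℝ → ℝ}
    (hf : IntegrableOn (fun x => Real.exp (-μ * x) * f x) (Ioi 0)) :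
    IntegrableOn (fun x => Real.exp (-μ * x) * fracIntegral ν f x) (Ioi 0) ∧
      ∫ x in Ioi (0 : ℝ), Real.exp (-μ * x) * fracIntegral ν f x =
        μ ^ (ν - 1) * ∫ x in Ioi (0 : ℝ), Real.exp (-μ * x) * f x := by
  set g : ℝ → ℝ := fun r => Real.exp (-μ * r) * (r ^ (-ν) / Real.Gamma (1 - ν)) with hg
  have hgi : IntegrableOn g (Ioi 0) := by
    have := (integrableOn_exp_mul_rpow_neg hν hμ).div_const (Real.Gamma (1 - ν))
    simpa only [hg, mul_div_assoc, IntegrableOn] using this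
  have key : ∀ x ∈ Ioi (0 : ℝ), ∫ t in (0 : ℝ)..x, (ContinuousLinearMap.mul ℝ ℝ
      (Real.exp (-μ * t) * f t)) (g (x - t)) = Real.exp (-μ * x) * fracIntegral ν f x := by
    intro x hx
    rw [fracIntegral, ← intervalIntegral.integral_const_mul, ← intervalIntegral.integral_const_mul]
    refine intervalIntegral.integral_congr fun t ht => ?_
    rw [uIcc_of_le (le_of_lt hx)] at ht
    simp only [ContinuousLinearMap.mul_apply', hg]
    rw [Real.rpow_neg (by linarith [ht.2]),
      show Real.exp (-μ * x) = Real.exp (-μ * t) * Real.exp (-μ * (x - t)) by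
        rw [← Real.exp_add]; ring_nf]
    ring
  constructor
  · have := (integrable_posConvolution hf hgi (ContinuousLinearMap.mul ℝ ℝ)).integrableOn
      (s := Ioi 0)
    refine (integrableOn_congr_fun (fun x hx => ?_) measurableSet_Ioi).1 this
    rw [posConvolution, indicator_of_mem hx, key x hx]
  · have := integral_posConvolution hf hgi (ContinuousLinearMap.mul ℝ ℝ)
    rw [setIntegral_congr_fun measurableSet_Ioi key] at this
    rw [this, ContinuousLinearMap.mul_apply', integral_exp_mul_rpow_neg hν hμ, mul_comm]

/-- Integration by parts; the boundary term at `∞` vanishes since `e^{-μx} F(x)` and its derivative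
are integrable. -/
theorem laplace_of_hasDerivAt {F F' : ℝ → ℝ} {μ : ℝ} (hF : ∀ x, 0 < x → HasDerivAt F (F' x) x)
    (h0 : Tendsto F (𝓝[>] 0) (𝓝 0))
    (hi : IntegrableOn (fun x => Real.exp (-μ * x) * F x) (Ioi 0))
    (hi' : IntegrableOn (fun x => Real.exp (-μ * x) * F' x) (Ioi 0)) :
    ∫ x in Ioi (0 : ℝ), Real.exp (-μ * x) * F' x =
      μ * ∫ x in Ioi (0 : ℝ), Real.exp (-μ * x) * F x := by
  have he : ∀ x, HasDerivAt (fun x => Real.exp (-μ * x)) (-μ * Real.exp (-μ * x)) x := fun x => by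
    have := ((hasDerivAt_id x).const_mul (-μ)).exp
    simpa [mul_comm] using this
  have hi1 : IntegrableOn (fun x => -μ * Real.exp (-μ * x) * F x) (Ioi 0) := by
    simpa only [mul_assoc, IntegrableOn] using hi.const_mul (-μ)
  have hzero : Tendsto (fun x => Real.exp (-μ * x) * F x) (𝓝[>] 0) (𝓝 0) := by
    have h1 : Tendsto (fun x => Real.exp (-μ * x)) (𝓝[>] 0) (𝓝 1) :=
      ((by fun_prop : Continuous fun x => Real.exp (-μ * x)).tendsto' 0 1 (by simp)).mono_left
        nhdsWithin_le_nhds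
    simpa using h1.mul h0
  have hinf : Tendsto (fun x => Real.exp (-μ * x) * F x) atTop (𝓝 0) :=
    tendsto_zero_of_hasDerivAt_of_integrableOn_Ioi (a := 0)
      (fun x hx => (he x).mul (hF x hx)) (hi1.add hi') hi
  have := integral_Ioi_mul_deriv_eq_deriv_mul (a := 0) (fun x _ => he x) (fun x hx => hF x hx)
    hi' hi1 hzero hinf
  rw [this, ← integral_const_mul, sub_zero, zero_sub, ← integral_neg]
  congr 1 with x
  ring

/-- In Laplace transforms `∑ j, λ_j ∂ ^ {ν_j}` is multiplication by `Ψ(μ) = ∑ j, λ_j μ ^ ν_j`, if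
the fractional integrals vanish at `0`. -/
theorem laplace_sum_rlDeriv {m : ℕ} {lam ν : Fin m → ℝ} (hν : ∀ j, ν j < 1) {μ : ℝ} (hμ : 0 < μ)
    {f : ℝ → ℝ} {d : Fin m → ℝ → ℝ} (hd : ∀ x, 0 < x → ∀ j, HasRLDerivAt (ν j) f (d j x) x)
    (h0 : ∀ j, Tendsto (fracIntegral (ν j) f) (𝓝[>] 0) (𝓝 0))
    (hi : IntegrableOn (fun x => Real.exp (-μ * x) * f x) (Ioi 0))
    (hi' : IntegrableOn (fun x => Real.exp (-μ * x) * ∑ j, lam j * d j x) (Ioi 0)) :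
    ∫ x in Ioi (0 : ℝ), Real.exp (-μ * x) * ∑ j, lam j * d j x =
      (∑ j, lam j * μ ^ ν j) * ∫ x in Ioi (0 : ℝ), Real.exp (-μ * x) * f x := by
  have e1 : ∀ x, Real.exp (-μ * x) * ∑ j, lam j * fracIntegral (ν j) f x =
      ∑ j, lam j * (Real.exp (-μ * x) * fracIntegral (ν j) f x) := fun x => by
    rw [Finset.mul_sum]
    exact Finset.sum_congr rfl fun j _ => by ring
  have hj := fun j => laplace_fracIntegral (hν j) hμ hi
  rw [laplace_of_hasDerivAt (F := fun x => ∑ j, lam j * fracIntegral (ν j) f x)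
    (fun x hx => HasDerivAt.fun_sum fun j _ => (hd x hx j).2.const_mul (lam j)) ?_ ?_ hi']
  · simp only [e1]
    rw [integral_finsetSum _ fun j _ => (hj j).1.const_mul _, Finset.mul_sum, Finset.sum_mul]
    refine Finset.sum_congr rfl fun j _ => ?_
    rw [integral_const_mul, (hj j).2, Real.rpow_sub_one hμ.ne']
    field_simp
  · have := tendsto_finsetSum Finset.univ fun j _ => (h0 j).const_mul (lam j)
    simpa using this
  · show IntegrableOn (fun x => Real.exp (-μ * x) * ∑ j, lam j * fracIntegral (ν j) f x) (Ioi 0)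
    simp only [e1]
    exact integrable_finsetSum _ fun j _ => (hj j).1.const_mul _

theorem eq_mul_exp_of_hasDerivAt {A : ℝ → ℝ} {k a : ℝ}
    (hA : ∀ t, 0 < t → HasDerivAt A (-k * A t) t) (h0 : Tendsto A (𝓝[>] 0) (𝓝 a)) {t : ℝ}
    (ht : 0 < t) : A t = a * Real.exp (-t * k) := by
  have hB : ∀ s, 0 < s → HasDerivAt (fun s => A s * Real.exp (s * k)) 0 s := fun s hs => by
    have h1 : HasDerivAt (fun s => Real.exp (s * k)) (Real.exp (s * k) * k) s := by
      simpa using ((hasDerivAt_id s).mul_const k).exp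
    exact ((hA s hs).mul h1).congr_deriv (by ring)
  have hc : ∀ s, 0 < s → A s * Real.exp (s * k) = A t * Real.exp (t * k) := fun s hs =>
    isOpen_Ioi.is_const_of_deriv_eq_zero (isPreconnected_Ioi (a := (0 : ℝ)))
      (fun s hs => (hB s hs).differentiableAt.differentiableWithinAt)
      (fun s hs => (hB s hs).deriv) hs ht
  have h1 : Tendsto (fun s => A s * Real.exp (s * k)) (𝓝[>] 0) (𝓝 (a * 1)) :=
    h0.mul (((by fun_prop : Continuous fun s => Real.exp (s * k)).tendsto' 0 1
      (by simp)).mono_left nhdsWithin_le_nhds)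
  have h2 : Tendsto (fun s => A s * Real.exp (s * k)) (𝓝[>] 0) (𝓝 (A t * Real.exp (t * k))) :=
    tendsto_const_nhds.congr' (by
      filter_upwards [self_mem_nhdsWithin] with s hs using (hc s hs).symm)
  have := tendsto_nhds_unique h1 h2
  rw [mul_one] at this
  rw [this, mul_assoc, ← Real.exp_add]
  simp

/-- The fractional integral of a function that is bounded near `0` vanishes at `0`. -/
theorem tendsto_fracIntegral_zero {ν : ℝ} (hν : ν ∈ Ioo (0 : ℝ) 1) {f : ℝ → ℝ}
    (hf : ContinuousOn f (Ici 0)) : Tendsto (fracIntegral ν f) (𝓝[>] 0) (𝓝 0) := by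
  obtain ⟨C, hC⟩ := (isCompact_Icc (a := (0 : ℝ)) (b := 1)).exists_bound_of_continuousOn
    (hf.mono Icc_subset_Ici_self)
  have hC0 : 0 ≤ C := (norm_nonneg _).trans (hC 0 (by simp))
  have hν1 : 0 < 1 - ν := by linarith [hν.2]
  have hG := Real.Gamma_pos_of_pos hν1
  have hlim : Tendsto (fun x : ℝ => 1 / Real.Gamma (1 - ν) * (C * (x ^ (1 - ν) / (1 - ν))))
      (𝓝[>] 0) (𝓝 0) := by
    have h1 : Tendsto (fun x : ℝ => x ^ (1 - ν)) (𝓝[>] 0) (𝓝 0) :=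
      ((Real.continuous_rpow_const hν1.le).tendsto' 0 0 (Real.zero_rpow hν1.ne')).mono_left
        nhdsWithin_le_nhds
    simpa using ((h1.div_const (1 - ν)).const_mul C).const_mul (1 / Real.Gamma (1 - ν))
  refine squeeze_zero_norm' ?_ hlim
  filter_upwards [Ioo_mem_nhdsGT (zero_lt_one' ℝ)] with x hx
  rw [fracIntegral, norm_mul, Real.norm_of_nonneg (by positivity)]
  gcongr
  have hker : ∫ s in (0 : ℝ)..x, (x - s) ^ (-ν) = x ^ (1 - ν) / (1 - ν) := by
    rw [intervalIntegral.integral_comp_sub_left (fun r : ℝ => r ^ (-ν)), sub_self, sub_zero,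
      integral_rpow (Or.inl (by linarith)), show -ν + 1 = 1 - ν by ring, Real.zero_rpow hν1.ne',
      sub_zero]
  have hki : IntervalIntegrable (fun s : ℝ => (x - s) ^ (-ν)) volume 0 x := by
    have := (intervalIntegral.intervalIntegrable_rpow' (a := x) (b := 0) (r := -ν)
      (by linarith)).comp_sub_left x
    simpa using this
  rw [← hker, ← intervalIntegral.integral_const_mul]
  refine intervalIntegral.norm_integral_le_of_norm_le hx.1.le
    (Eventually.of_forall fun s hs => ?_) (hki.const_mul C)
  rw [norm_div, Real.norm_of_nonneg (r := (x - s) ^ ν) (Real.rpow_nonneg (by linarith [hs.2]) _),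
    Real.rpow_neg (by linarith [hs.2]), div_eq_mul_inv]
  have : 0 ≤ ((x - s) ^ ν)⁻¹ := inv_nonneg.2 (Real.rpow_nonneg (by linarith [hs.2]) _)
  gcongr
  exact hC s ⟨hs.1.le, hs.2.trans hx.2.le⟩

/-! ### Uniqueness -/

/-- The Laplace transform `A(t)` of a solution satisfies `A' = -Ψ(μ) A` and `A(0+) = 1`. -/
theorem SolvesDensityProblem.laplace_eq {m : ℕ} {lam ν : Fin m → ℝ} {u : ℝ → ℝ → ℝ}
    (hν : ∀ j, ν j ∈ Ioo (0 : ℝ) 1) (hu : SolvesDensityProblem lam ν u) {t μ : ℝ} (ht : 0 < t)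
    (hμ : 0 < μ) :
    IntegrableOn (fun x => Real.exp (-μ * x) * u x t) (Ioi 0) ∧
      ∫ x in Ioi (0 : ℝ), Real.exp (-μ * x) * u x t =
        Real.exp (-t * ∑ j, lam j * μ ^ ν j) := by
  have hint : ∀ t, 0 < t → IntegrableOn (fun x => Real.exp (-μ * x) * u x t) (Ioi 0) := by
    intro t ht
    refine Integrable.mono (hu.integrableOn t ht) ?_ ?_
    · exact AEStronglyMeasurable.mul (by fun_prop) (hu.integrableOn t ht).aestronglyMeasurable
    · filter_upwards [ae_restrict_mem measurableSet_Ioi] with x hx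
      have hx : 0 < x := hx
      rw [norm_mul, Real.norm_of_nonneg (Real.exp_nonneg _)]
      refine mul_le_of_le_one_left (norm_nonneg _) (Real.exp_le_one_iff.2 ?_)
      rw [neg_mul]
      exact neg_nonpos.2 (by positivity)
  refine ⟨hint t ht, ?_⟩
  choose! d hd hdt using hu.equation
  have hder : ∀ x t, 0 < x → 0 < t → deriv (fun s => u x s) t = -∑ j, lam j * d x t j :=
    fun x t hx ht => (hdt x t hx ht).deriv
  have hode : ∀ t, 0 < t → HasDerivAt (fun s => ∫ x in Ioi (0 : ℝ), Real.exp (-μ * x) * u x s)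
      (-(∑ j, lam j * μ ^ ν j) * ∫ x in Ioi (0 : ℝ), Real.exp (-μ * x) * u x t) t := by
    intro t ht
    convert hu.laplace_deriv t μ ht hμ using 1
    have e : EqOn (fun x => Real.exp (-μ * x) * deriv (fun s => u x s) t)
        (fun x => -(Real.exp (-μ * x) * ∑ j, lam j * d x t j)) (Ioi 0) := fun x hx => by
      simp only [hder x t hx ht, mul_neg]
    have hi := (integrableOn_congr_fun e measurableSet_Ioi).1 (hu.laplace_integrable t μ ht hμ)
    rw [setIntegral_congr_fun measurableSet_Ioi e, integral_neg, neg_mul,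
      laplace_sum_rlDeriv (fun j => (hν j).2) hμ (d := fun j x => d x t j)
        (fun x hx j => hd x t hx ht j)
        (fun j => tendsto_fracIntegral_zero (hν j) (hu.continuousOn t ht)) (hint t ht)
        (by simpa using hi.neg)]
  have h0 : Tendsto (fun s => ∫ x in Ioi (0 : ℝ), Real.exp (-μ * x) * u x s) (𝓝[>] 0) (𝓝 1) := by
    let φ : ℝ →ᵇ ℝ := BoundedContinuousFunction.ofNormedAddCommGroup
      (fun x => Real.exp (-μ * |x|)) (by fun_prop) 1 (fun x => by
        rw [Real.norm_of_nonneg (Real.exp_nonneg _), Real.exp_le_one_iff, neg_mul]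
        exact neg_nonpos.2 (by positivity))
    have h := hu.initial φ
    have e0 : φ 0 = 1 := by simp [φ]
    rw [e0] at h
    refine h.congr fun s => setIntegral_congr_fun measurableSet_Ioi fun x hx => ?_
    have hx : 0 < x := hx
    simp [φ, abs_of_pos hx]
  rw [eq_mul_exp_of_hasDerivAt hode h0 ht, one_mul]

theorem SolvesDensityProblem.eq {m : ℕ} {lam ν : Fin m → ℝ} {u v : ℝ → ℝ → ℝ}
    (hν : ∀ j, ν j ∈ Ioo (0 : ℝ) 1) (hu : SolvesDensityProblem lam ν u)
    (hv : SolvesDensityProblem lam ν v) {x t : ℝ} (hx : 0 ≤ x) (ht : 0 < t) : u x t = v x t := by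
  rcases hx.eq_or_lt with rfl | hx
  · rw [hu.boundary t ht, hv.boundary t ht]
  have e : ∀ μ x, Real.exp (-μ * x) * (u x t - v x t) =
    Real.exp (-μ * x) * u x t - Real.exp (-μ * x) * v x t := fun μ x => mul_sub _ _ _
  refine sub_eq_zero.1 (eq_zero_of_laplace_eq_zero (f := fun x => u x t - v x t) ?_ ?_ ?_ hx)
  · exact ((hu.continuousOn t ht).sub (hv.continuousOn t ht)).mono Ioi_subset_Ici_self
  · intro μ hμ
    simp only [e]
    exact (hu.laplace_eq hν ht hμ).1.sub (hv.laplace_eq hν ht hμ).1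
  · intro μ hμ
    simp only [e]
    rw [integral_sub (hu.laplace_eq hν ht hμ).1 (hv.laplace_eq hν ht hμ).1,
      (hu.laplace_eq hν ht hμ).2, (hv.laplace_eq hν ht hμ).2, sub_self]

theorem laplace_boundary_value {m : ℕ} {lam ν : Fin m → ℝ} (hν : ∀ j, ν j ∈ Ioo (0 : ℝ) 1)
    {μ : ℝ} (hμ : 0 < μ) :
    ∫ t in Ioi (0 : ℝ), Real.exp (-μ * t) *
      ∑ j, lam j * (t ^ (-ν j) / Real.Gamma (1 - ν j)) = ∑ j, lam j * μ ^ (ν j - 1) := by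
  have e : ∀ t, Real.exp (-μ * t) * ∑ j, lam j * (t ^ (-ν j) / Real.Gamma (1 - ν j)) =
      ∑ j, lam j * (Real.exp (-μ * t) * (t ^ (-ν j) / Real.Gamma (1 - ν j))) := fun t => by
    rw [Finset.mul_sum]
    exact Finset.sum_congr rfl fun j _ => by ring
  simp only [e]
  rw [integral_finsetSum]
  · refine Finset.sum_congr rfl fun j _ => ?_
    rw [integral_const_mul, integral_exp_mul_rpow_neg (hν j).2 hμ]
  · intro j _
    have := ((integrableOn_exp_mul_rpow_neg (hν j).2 hμ).div_const
      (Real.Gamma (1 - ν j))).const_mul (lam j)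
    simpa only [mul_div_assoc] using this

/-- The Laplace transform in `t` of a solution satisfies `A'(x) = -Ψ(μ) A(x)`, with the transform of
the boundary value as `A(0+)`. -/
theorem SolvesInverseProblem.laplace_eq {m : ℕ} {lam ν : Fin m → ℝ} {u : ℝ → ℝ → ℝ}
    (hν : ∀ j, ν j ∈ Ioo (0 : ℝ) 1) (hu : SolvesInverseProblem lam ν u) {x μ : ℝ} (hx : 0 < x)
    (hμ : 0 < μ) :
    ∫ t in Ioi (0 : ℝ), Real.exp (-μ * t) * u x t =
      (∑ j, lam j * μ ^ (ν j - 1)) * Real.exp (-x * ∑ j, lam j * μ ^ ν j) := by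
  choose! d hd hdx using hu.equation
  have hode : ∀ x, 0 < x → HasDerivAt (fun y => ∫ t in Ioi (0 : ℝ), Real.exp (-μ * t) * u y t)
      (-(∑ j, lam j * μ ^ ν j) * ∫ t in Ioi (0 : ℝ), Real.exp (-μ * t) * u x t) x := by
    intro x hx
    convert hu.laplace_deriv x μ hx hμ using 1
    have e : EqOn (fun t => Real.exp (-μ * t) * deriv (fun y => u y t) x)
        (fun t => -(Real.exp (-μ * t) * ∑ j, lam j * d x t j)) (Ioi 0) := fun t ht => by
      simp only [(hdx x t hx ht).deriv, mul_neg]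
    have hi := (integrableOn_congr_fun e measurableSet_Ioi).1 (hu.laplace_integrable x μ hx hμ).2
    rw [setIntegral_congr_fun measurableSet_Ioi e, integral_neg, neg_mul,
      laplace_sum_rlDeriv (fun j => (hν j).2) hμ (d := fun j t => d x t j)
        (fun t ht j => hd x t hx ht j)
        (fun j => hu.fracIntegral_zero x hx j) (hu.laplace_integrable x μ hx hμ).1
        (by simpa using hi.neg)]
  have h0 := hu.laplace_boundary μ hμ
  rw [setIntegral_congr_fun (g := fun t => Real.exp (-μ * t) *
      ∑ j, lam j * (t ^ (-ν j) / Real.Gamma (1 - ν j))) measurableSet_Ioi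
      (fun t ht => by simp only [hu.boundary t ht]), laplace_boundary_value hν hμ] at h0
  exact eq_mul_exp_of_hasDerivAt hode h0 hx

theorem SolvesInverseProblem.eq {m : ℕ} {lam ν : Fin m → ℝ} {u v : ℝ → ℝ → ℝ}
    (hν : ∀ j, ν j ∈ Ioo (0 : ℝ) 1) (hu : SolvesInverseProblem lam ν u)
    (hv : SolvesInverseProblem lam ν v) {x t : ℝ} (hx : 0 ≤ x) (ht : 0 < t) : u x t = v x t := by
  rcases hx.eq_or_lt with rfl | hx
  · rw [hu.boundary t ht, hv.boundary t ht]
  have e : ∀ μ t, Real.exp (-μ * t) * (u x t - v x t) =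
    Real.exp (-μ * t) * u x t - Real.exp (-μ * t) * v x t := fun μ t => mul_sub _ _ _
  refine sub_eq_zero.1 (eq_zero_of_laplace_eq_zero (f := fun t => u x t - v x t) ?_ ?_ ?_ ht)
  · exact (hu.continuousOn x hx).sub (hv.continuousOn x hx)
  · intro μ hμ
    simp only [e]
    exact (hu.laplace_integrable x μ hx hμ).1.sub (hv.laplace_integrable x μ hx hμ).1
  · intro μ hμ
    simp only [e]
    rw [integral_sub (hu.laplace_integrable x μ hx hμ).1 (hv.laplace_integrable x μ hx hμ).1,
      hu.laplace_eq hν hx hμ, hv.laplace_eq hν hx hμ, sub_self]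

/-! ### The Laplace exponent -/

/-- The Laplace exponent `Ψ(z) = ∑ j, λ_j z ^ ν_j` of `∑ j, λ_j ^ (1 / ν_j) H_j`, with the principal
branch of the powers. -/
noncomputable def laplaceExponent {m : ℕ} (lam ν : Fin m → ℝ) (z : ℂ) : ℂ :=
  ∑ j, (lam j : ℂ) * z ^ (ν j : ℂ)

theorem mem_slitPlane_of_re_pos {z : ℂ} (hz : 0 < z.re) : z ∈ Complex.slitPlane := Or.inl hz

theorem continuousOn_cpow_re_pos (a : ℂ) : ContinuousOn (fun z : ℂ => z ^ a) {z | 0 < z.re} :=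
  fun _ hz =>
    ((hasDerivAt_id _).cpow_const (mem_slitPlane_of_re_pos hz)).continuousAt.continuousWithinAt

theorem laplaceExponent_ofReal {m : ℕ} (lam ν : Fin m → ℝ) {μ : ℝ} (hμ : 0 ≤ μ) :
    laplaceExponent lam ν μ = ((∑ j, lam j * μ ^ ν j : ℝ) : ℂ) := by
  simp only [laplaceExponent]
  push_cast
  simp only [Complex.ofReal_cpow hμ]

theorem laplaceExponent_eq_mul {m : ℕ} (lam ν : Fin m → ℝ) {z : ℂ} (hz : 0 < z.re) :
    laplaceExponent lam ν z = z * laplaceExponent lam (fun j => ν j - 1) z := by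
  have hz0 : z ≠ 0 := Complex.slitPlane_ne_zero (mem_slitPlane_of_re_pos hz)
  rw [laplaceExponent, laplaceExponent, Finset.mul_sum]
  refine Finset.sum_congr rfl fun j _ => ?_
  rw [Complex.ofReal_sub, Complex.ofReal_one, Complex.cpow_sub _ _ hz0, Complex.cpow_one]
  field_simp

theorem hasDerivAt_laplaceExponent {m : ℕ} (lam ν : Fin m → ℝ) {z : ℂ} (hz : 0 < z.re) :
    HasDerivAt (laplaceExponent lam ν)
      (laplaceExponent (fun j => lam j * ν j) (fun j => ν j - 1) z) z := by
  have : HasDerivAt (fun z => ∑ j, (lam j : ℂ) * z ^ (ν j : ℂ))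
      (∑ j, (lam j : ℂ) * ((ν j : ℂ) * z ^ ((ν j : ℂ) - 1) * 1)) z :=
    HasDerivAt.fun_sum fun j _ =>
      ((hasDerivAt_id z).cpow_const (mem_slitPlane_of_re_pos hz)).const_mul _
  refine this.congr_deriv (Finset.sum_congr rfl fun j _ => ?_)
  push_cast
  ring

theorem differentiableOn_laplaceExponent {m : ℕ} (lam ν : Fin m → ℝ) :
    DifferentiableOn ℂ (laplaceExponent lam ν) {z | 0 < z.re} := fun _ hz =>
  (hasDerivAt_laplaceExponent lam ν hz).differentiableAt.differentiableWithinAt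

theorem norm_laplaceExponent_le {m : ℕ} (lam ν : Fin m → ℝ) (z : ℂ) :
    ‖laplaceExponent lam ν z‖ ≤ ∑ j, |lam j| * ‖z‖ ^ ν j := by
  refine norm_sum_le_of_le _ fun j _ => ?_
  rw [norm_mul, Complex.norm_cpow_real, Complex.norm_real, Real.norm_eq_abs]

/-- The decay rate of `e^{-tΨ}` contributed by the `j`-th summand. -/
noncomputable def decayRate {m : ℕ} (lam ν : Fin m → ℝ) (j : Fin m) : ℝ :=
  lam j * Real.cos (ν j * (Real.pi / 2))

theorem decayRate_pos {m : ℕ} {lam ν : Fin m → ℝ} (hlam : ∀ j, 0 < lam j)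
    (hν : ∀ j, ν j ∈ Ioo (0 : ℝ) 1) (j : Fin m) : 0 < decayRate lam ν j := by
  refine mul_pos (hlam j) (Real.cos_pos_of_mem_Ioo ⟨?_, ?_⟩)
  · have := mul_pos (hν j).1 Real.pi_div_two_pos
    linarith [Real.pi_div_two_pos]
  · nlinarith [(hν j).2, Real.pi_div_two_pos]

/-- On the right half-plane every summand of `Re Ψ` is nonnegative, so each of them bounds `Re Ψ`
from below. -/
theorem decayRate_mul_le_re {m : ℕ} {lam ν : Fin m → ℝ} (hlam : ∀ j, 0 < lam j)
    (hν : ∀ j, ν j ∈ Ioo (0 : ℝ) 1) (j : Fin m) {z : ℂ} (hz : 0 < z.re) :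
    decayRate lam ν j * ‖z‖ ^ ν j ≤ (laplaceExponent lam ν z).re := by
  have harg : |z.arg| ≤ Real.pi / 2 := Complex.abs_arg_le_pi_div_two_iff.2 hz.le
  have hcos : ∀ k, Real.cos (ν k * (Real.pi / 2)) ≤ Real.cos (z.arg * ν k) := fun k => by
    rw [← Real.cos_abs (z.arg * ν k), abs_mul, abs_of_pos (hν k).1, mul_comm]
    refine Real.cos_le_cos_of_nonneg_of_le_pi (by have := (hν k).1; positivity) ?_ ?_
    · nlinarith [(hν k).2, Real.pi_pos]
    · exact mul_le_mul_of_nonneg_right harg (hν k).1.le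
  have hk : ∀ k, decayRate lam ν k * ‖z‖ ^ ν k ≤ ((lam k : ℂ) * z ^ (ν k : ℂ)).re := fun k => by
    rw [Complex.re_ofReal_mul, Complex.cpow_ofReal_re, decayRate, mul_assoc,
      mul_comm (Real.cos _)]
    have := (hlam k).le
    gcongr
    exact hcos k
  rw [laplaceExponent, Complex.re_sum]
  refine (hk j).trans (Finset.single_le_sum (f := fun k => ((lam k : ℂ) * z ^ (ν k : ℂ)).re)
    (fun k _ => ?_) (Finset.mem_univ j))
  exact le_trans (mul_nonneg (decayRate_pos hlam hν k).le (Real.rpow_nonneg (norm_nonneg _) _))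
    (hk k)

theorem norm_exp_neg_mul_laplaceExponent_le {m : ℕ} {lam ν : Fin m → ℝ} (hlam : ∀ j, 0 < lam j)
    (hν : ∀ j, ν j ∈ Ioo (0 : ℝ) 1) (j : Fin m) {z : ℂ} (hz : 0 < z.re) {t : ℝ} (ht : 0 ≤ t) :
    ‖Complex.exp (-t * laplaceExponent lam ν z)‖ ≤
      Real.exp (-(t * decayRate lam ν j) * ‖z‖ ^ ν j) := by
  rw [Complex.norm_exp, ← Complex.ofReal_neg, Complex.re_ofReal_mul, Real.exp_le_exp]
  have := mul_le_mul_of_nonneg_left (decayRate_mul_le_re hlam hν j hz) ht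
  linarith

/-- Stretched exponentials beat powers. With `q = (1 + r) ^ p ≤ 1 + r ^ p` this is the bound
`q ^ K e^{-aq} ≤ K! / a ^ K`. -/
theorem exists_pow_mul_exp_neg_rpow_le {a p : ℝ} (ha : 0 < a) (hp : p ∈ Ioo (0 : ℝ) 1) (N : ℕ) :
    ∃ C, ∀ r, 0 ≤ r → (1 + r) ^ N * Real.exp (-a * r ^ p) ≤ C := by
  obtain ⟨K, hK⟩ := exists_nat_ge ((N : ℝ) / p)
  refine ⟨Real.exp a * (K.factorial / a ^ K), fun r hr => ?_⟩
  set q := (1 + r) ^ p with hq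
  have hq1 : 1 ≤ q := Real.one_le_rpow (by linarith) hp.1.le
  have h1 : q - 1 ≤ r ^ p := by
    have := Real.rpow_add_le_add_rpow zero_le_one hr hp.1.le hp.2.le
    rw [Real.one_rpow] at this
    linarith
  have h2 : (1 + r) ^ N ≤ q ^ K := by
    rw [← Real.rpow_natCast, ← Real.rpow_natCast, hq, ← Real.rpow_mul (by linarith)]
    refine Real.rpow_le_rpow_of_exponent_le (by linarith) ?_
    rwa [div_le_iff₀ hp.1, mul_comm] at hK
  have h3 : q ^ K * Real.exp (-a * q) ≤ K.factorial / a ^ K := by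
    have := Real.pow_div_factorial_le_exp (a * q) (by positivity) K
    rw [div_le_iff₀ (by positivity), mul_pow] at this
    rw [le_div_iff₀ (by positivity), neg_mul, Real.exp_neg]
    field_simp
    linarith
  calc (1 + r) ^ N * Real.exp (-a * r ^ p) ≤ q ^ K * Real.exp (a + -a * q) := by
        gcongr
        nlinarith
    _ = Real.exp a * (q ^ K * Real.exp (-a * q)) := by rw [Real.exp_add]; ring
    _ ≤ _ := by gcongr

/-! ### Functions of polynomial growth on the right half-plane -/

/-- `g` is continuous on `Re z > 0` and of polynomial growth on every half-plane `Re z ≥ c > 0`. -/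
structure PolyGrowth (g : ℂ → ℂ) : Prop where
  continuousOn : ContinuousOn g {z | 0 < z.re}
  bound : ∀ c : ℝ, 0 < c → ∃ (C : ℝ) (N : ℕ), 0 ≤ C ∧ ∀ z : ℂ, c ≤ z.re → ‖g z‖ ≤ C * (1 + ‖z‖) ^ N

theorem PolyGrowth.const (a : ℂ) : PolyGrowth fun _ => a :=
  ⟨continuousOn_const, fun _ _ => ⟨‖a‖, 0, norm_nonneg _, fun z _ => by simp⟩⟩

theorem PolyGrowth.id : PolyGrowth fun z => z :=
  ⟨continuousOn_id, fun _ _ => ⟨1, 1, zero_le_one, fun z _ => by simp⟩⟩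

theorem PolyGrowth.mul {f g : ℂ → ℂ} (hf : PolyGrowth f) (hg : PolyGrowth g) :
    PolyGrowth fun z => f z * g z := by
  refine ⟨hf.continuousOn.mul hg.continuousOn, fun c hc => ?_⟩
  obtain ⟨C, N, hC, h⟩ := hf.bound c hc
  obtain ⟨C', N', hC', h'⟩ := hg.bound c hc
  refine ⟨C * C', N + N', by positivity, fun z hz => ?_⟩
  rw [norm_mul, pow_add, mul_mul_mul_comm]
  exact mul_le_mul (h z hz) (h' z hz) (norm_nonneg _) (by positivity)

theorem PolyGrowth.add {f g : ℂ → ℂ} (hf : PolyGrowth f) (hg : PolyGrowth g) :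
    PolyGrowth fun z => f z + g z := by
  refine ⟨hf.continuousOn.add hg.continuousOn, fun c hc => ?_⟩
  obtain ⟨C, N, hC, h⟩ := hf.bound c hc
  obtain ⟨C', N', hC', h'⟩ := hg.bound c hc
  refine ⟨C + C', N + N', by positivity, fun z hz => ?_⟩
  have h1 : 1 ≤ 1 + ‖z‖ := by linarith [norm_nonneg z]
  have e1 : (1 + ‖z‖) ^ N ≤ (1 + ‖z‖) ^ (N + N') := pow_le_pow_right₀ h1 (by omega)
  have e2 : (1 + ‖z‖) ^ N' ≤ (1 + ‖z‖) ^ (N + N') := pow_le_pow_right₀ h1 (by omega)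
  calc ‖f z + g z‖ ≤ C * (1 + ‖z‖) ^ N + C' * (1 + ‖z‖) ^ N' :=
        (norm_add_le _ _).trans (add_le_add (h z hz) (h' z hz))
    _ ≤ C * (1 + ‖z‖) ^ (N + N') + C' * (1 + ‖z‖) ^ (N + N') := by gcongr
    _ = _ := by ring

theorem PolyGrowth.neg {f : ℂ → ℂ} (hf : PolyGrowth f) : PolyGrowth fun z => -f z := by
  simpa using (PolyGrowth.const (-1)).mul hf

theorem PolyGrowth.sum {ι : Type*} (s : Finset ι) {f : ι → ℂ → ℂ} (hf : ∀ i ∈ s, PolyGrowth (f i)) :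
    PolyGrowth fun z => ∑ i ∈ s, f i z := by
  classical
  induction s using Finset.induction_on with
  | empty => simpa using PolyGrowth.const 0
  | insert a s ha ih =>
    simp only [Finset.sum_insert ha]
    exact (hf a (by simp)).add (ih fun i hi => hf i (by simp [hi]))

theorem PolyGrowth.cpow (a : ℝ) : PolyGrowth fun z => z ^ (a : ℂ) := by
  refine ⟨continuousOn_cpow_re_pos _, fun c hc => ?_⟩
  rcases le_total 0 a with ha | ha
  · obtain ⟨N, hN⟩ := exists_nat_ge a
    refine ⟨1, N, zero_le_one, fun z _ => ?_⟩
    rw [Complex.norm_cpow_real, one_mul, ← Real.rpow_natCast]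
    calc ‖z‖ ^ a ≤ (1 + ‖z‖) ^ a := by gcongr; linarith
      _ ≤ (1 + ‖z‖) ^ (N : ℝ) := by
        refine Real.rpow_le_rpow_of_exponent_le ?_ hN
        linarith [norm_nonneg z]
  · refine ⟨c ^ a, 0, by positivity, fun z hz => ?_⟩
    rw [Complex.norm_cpow_real, pow_zero, mul_one]
    exact Real.rpow_le_rpow_of_nonpos hc (hz.trans (Complex.re_le_norm z)) ha

theorem PolyGrowth.laplaceExponent {m : ℕ} (lam ν : Fin m → ℝ) :
    PolyGrowth (laplaceExponent lam ν) :=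
  PolyGrowth.sum _ fun j _ => (PolyGrowth.const _).mul (PolyGrowth.cpow (ν j))

/-! ### Bromwich integrals -/

/-- The point of height `2πw` on the vertical line `Re z = c`. -/
noncomputable def verticalLine (c w : ℝ) : ℂ := c + 2 * Real.pi * w * Complex.I

@[simp]
theorem verticalLine_re (c w : ℝ) : (verticalLine c w).re = c := by simp [verticalLine]

theorem continuous_verticalLine (c : ℝ) : Continuous (verticalLine c) := by
  unfold verticalLine
  fun_prop

theorem one_add_sq_le_norm_verticalLine (c w : ℝ) :
    1 + w ^ 2 ≤ (1 + ‖verticalLine c w‖) ^ 2 := by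
  have h := Complex.abs_im_le_norm (verticalLine c w)
  have e : (verticalLine c w).im = 2 * Real.pi * w := by simp [verticalLine]
  rw [e, abs_mul, abs_of_pos (by positivity)] at h
  have h2 : |w| ≤ ‖verticalLine c w‖ := by
    nlinarith [Real.pi_gt_three, abs_nonneg w]
  nlinarith [sq_abs w, abs_nonneg w]

theorem PolyGrowth.continuous_verticalLine {g : ℂ → ℂ} (hg : PolyGrowth g) {c : ℝ} (hc : 0 < c) :
    Continuous fun w => g (verticalLine c w) :=
  hg.continuousOn.comp_continuous (_root_.continuous_verticalLine c) fun w => by simpa using hc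

/-- The inverse Laplace transform of `g(z) e^{-tΨ(z)}`, written as an integral over the line
`Re z = c`; the parametrisation by `w ↦ c + 2πiw` absorbs the factor `1 / (2πi)`. -/
noncomputable def bromwich {m : ℕ} (lam ν : Fin m → ℝ) (c : ℝ) (g : ℂ → ℂ) (x t : ℝ) : ℂ :=
  ∫ w : ℝ, Complex.exp (verticalLine c w * x) *
    (Complex.exp (-t * laplaceExponent lam ν (verticalLine c w)) * g (verticalLine c w))

section

variable {m : ℕ} {lam ν : Fin m → ℝ} {g : ℂ → ℂ} {c : ℝ}

theorem norm_exp_verticalLine_mul (c w x : ℝ) :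
    ‖Complex.exp (verticalLine c w * x)‖ = Real.exp (c * x) := by
  rw [Complex.norm_exp, Complex.re_mul_ofReal, verticalLine_re]

theorem continuous_bromwich_integrand (hg : PolyGrowth g) (hc : 0 < c) (x t : ℝ) :
    Continuous fun w => Complex.exp (verticalLine c w * x) *
      (Complex.exp (-t * laplaceExponent lam ν (verticalLine c w)) * g (verticalLine c w)) := by
  have h1 := continuous_verticalLine c
  have h2 := (PolyGrowth.laplaceExponent lam ν).continuous_verticalLine hc
  have h3 := hg.continuous_verticalLine hc
  exact (h1.mul continuous_const).cexp.mul ((continuous_const.mul h2).cexp.mul h3)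

/-- The integrands of `bromwich` are dominated by a multiple of `1 / (1 + w²)`, uniformly for
times bounded away from `0`. -/
theorem exists_bromwich_dominated (hm : 1 ≤ m) (hlam : ∀ j, 0 < lam j)
    (hν : ∀ j, ν j ∈ Ioo (0 : ℝ) 1) (hg : PolyGrowth g) (hc : 0 < c) {T : ℝ} (hT : 0 < T) :
    ∃ B, ∀ t, T ≤ t → ∀ w, ‖Complex.exp (-t * laplaceExponent lam ν (verticalLine c w)) *
      g (verticalLine c w)‖ ≤ B * (1 + w ^ 2)⁻¹ := by
  let j : Fin m := ⟨0, hm⟩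
  have hκ := decayRate_pos hlam hν j
  obtain ⟨C, N, hC, hb⟩ := hg.bound c hc
  obtain ⟨D, hD⟩ := exists_pow_mul_exp_neg_rpow_le (mul_pos hT hκ) (hν j) (N + 2)
  refine ⟨C * D, fun t ht w => ?_⟩
  set z := verticalLine c w with hz
  have hzre : z.re = c := verticalLine_re c w
  have h1 := norm_exp_neg_mul_laplaceExponent_le hlam hν j (z := z) (hzre ▸ hc) (hT.le.trans ht)
  have h2 : Real.exp (-(t * decayRate lam ν j) * ‖z‖ ^ ν j) ≤
      Real.exp (-(T * decayRate lam ν j) * ‖z‖ ^ ν j) := by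
    rw [neg_mul, neg_mul]
    gcongr
  have h3 := hD ‖z‖ (norm_nonneg _)
  have h4 := one_add_sq_le_norm_verticalLine c w
  rw [← hz] at h4
  have hD0 : 0 ≤ D := le_trans (by positivity) h3
  rw [norm_mul, ← div_eq_mul_inv, le_div_iff₀ (by positivity)]
  calc ‖Complex.exp (-t * laplaceExponent lam ν z)‖ * ‖g z‖ * (1 + w ^ 2)
      ≤ Real.exp (-(T * decayRate lam ν j) * ‖z‖ ^ ν j) * (C * (1 + ‖z‖) ^ N) *
        (1 + ‖z‖) ^ 2 := by
        gcongr
        · exact h1.trans h2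
        · exact hb z hzre.ge
    _ = C * ((1 + ‖z‖) ^ (N + 2) * Real.exp (-(T * decayRate lam ν j) * ‖z‖ ^ ν j)) := by ring
    _ ≤ C * D := by gcongr

theorem integrable_exp_mul (hm : 1 ≤ m) (hlam : ∀ j, 0 < lam j)
    (hν : ∀ j, ν j ∈ Ioo (0 : ℝ) 1) (hg : PolyGrowth g) (hc : 0 < c) {t : ℝ} (ht : 0 < t) :
    Integrable fun w => Complex.exp (-t * laplaceExponent lam ν (verticalLine c w)) *
      g (verticalLine c w) := by
  obtain ⟨B, hB⟩ := exists_bromwich_dominated hm hlam hν hg hc ht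
  refine (integrable_inv_one_add_sq.const_mul B).mono' ?_
    (Eventually.of_forall fun w => hB t le_rfl w)
  simpa using (continuous_bromwich_integrand (lam := lam) (ν := ν) hg hc 0 t).aestronglyMeasurable

theorem integrable_bromwich (hm : 1 ≤ m) (hlam : ∀ j, 0 < lam j)
    (hν : ∀ j, ν j ∈ Ioo (0 : ℝ) 1) (hg : PolyGrowth g) (hc : 0 < c) (x : ℝ) {t : ℝ} (ht : 0 < t) :
    Integrable fun w => Complex.exp (verticalLine c w * x) *
      (Complex.exp (-t * laplaceExponent lam ν (verticalLine c w)) * g (verticalLine c w)) := by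
  refine ((integrable_exp_mul hm hlam hν hg hc ht).norm.const_mul (Real.exp (c * x))).mono'
    (continuous_bromwich_integrand hg hc x t).aestronglyMeasurable
    (Eventually.of_forall fun w => ?_)
  rw [norm_mul, norm_exp_verticalLine_mul]

theorem exists_norm_bromwich_le (hm : 1 ≤ m) (hlam : ∀ j, 0 < lam j)
    (hν : ∀ j, ν j ∈ Ioo (0 : ℝ) 1) (hg : PolyGrowth g) (hc : 0 < c) {T : ℝ} (hT : 0 < T) :
    ∃ B, ∀ t, T ≤ t → ∀ x, ‖bromwich lam ν c g x t‖ ≤ B * Real.exp (c * x) := by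
  obtain ⟨B, hB⟩ := exists_bromwich_dominated hm hlam hν hg hc hT
  refine ⟨∫ w : ℝ, B * (1 + w ^ 2)⁻¹, fun t ht x => ?_⟩
  rw [mul_comm, ← integral_const_mul]
  refine norm_integral_le_of_norm_le ((integrable_inv_one_add_sq.const_mul B).const_mul _)
    (Eventually.of_forall fun w => ?_)
  rw [norm_mul, norm_exp_verticalLine_mul]
  exact mul_le_mul_of_nonneg_left (hB t ht w) (Real.exp_nonneg _)

theorem hasDerivAt_bromwich_space (hm : 1 ≤ m) (hlam : ∀ j, 0 < lam j)
    (hν : ∀ j, ν j ∈ Ioo (0 : ℝ) 1) (hg : PolyGrowth g) (hc : 0 < c) (x : ℝ) {t : ℝ} (ht : 0 < t) :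
    HasDerivAt (fun y => bromwich lam ν c g y t) (bromwich lam ν c (fun z => z * g z) x t) x := by
  have hi := integrable_exp_mul hm hlam hν (PolyGrowth.id.mul hg) hc ht
  refine (hasDerivAt_integral_of_dominated_loc_of_deriv_le (Metric.ball_mem_nhds x one_pos)
    (bound := fun w => Real.exp (c * (x + 1)) *
      ‖Complex.exp (-t * laplaceExponent lam ν (verticalLine c w)) *
        (verticalLine c w * g (verticalLine c w))‖)
    (Eventually.of_forall fun y => (continuous_bromwich_integrand hg hc y t).aestronglyMeasurable)
    (integrable_bromwich hm hlam hν hg hc x ht)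
    (continuous_bromwich_integrand (PolyGrowth.id.mul hg) hc x t).aestronglyMeasurable
    (Eventually.of_forall fun w y hy => ?_) (hi.norm.const_mul _)
    (F' := fun y w => Complex.exp (verticalLine c w * y) *
      (Complex.exp (-t * laplaceExponent lam ν (verticalLine c w)) *
        (verticalLine c w * g (verticalLine c w))))
    (Eventually.of_forall fun w y _ => ?_)).2
  · rw [norm_mul, norm_exp_verticalLine_mul]
    have : y < x + 1 := by
      have := (abs_lt.1 (Metric.mem_ball.1 hy)).2
      linarith
    gcongr
  · have h1 : HasDerivAt (fun y : ℝ => verticalLine c w * (y : ℂ)) (verticalLine c w * 1) y :=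
      (Complex.ofRealCLM.hasDerivAt (x := y)).const_mul _
    exact (h1.cexp.mul_const _).congr_deriv (by ring)

theorem hasDerivAt_bromwich_time (hm : 1 ≤ m) (hlam : ∀ j, 0 < lam j)
    (hν : ∀ j, ν j ∈ Ioo (0 : ℝ) 1) (hg : PolyGrowth g) (hc : 0 < c) (x : ℝ) {t : ℝ} (ht : 0 < t) :
    HasDerivAt (fun s => bromwich lam ν c g x s)
      (bromwich lam ν c (fun z => -laplaceExponent lam ν z * g z) x t) t := by
  have hg' : PolyGrowth fun z => -laplaceExponent lam ν z * g z :=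
    (PolyGrowth.laplaceExponent lam ν).neg.mul hg
  obtain ⟨B, hB⟩ := exists_bromwich_dominated hm hlam hν hg' hc (half_pos ht)
  refine (hasDerivAt_integral_of_dominated_loc_of_deriv_le (Ioi_mem_nhds (half_lt_self ht))
    (bound := fun w => Real.exp (c * x) * (B * (1 + w ^ 2)⁻¹))
    (Eventually.of_forall fun s => (continuous_bromwich_integrand hg hc x s).aestronglyMeasurable)
    (integrable_bromwich hm hlam hν hg hc x ht)
    (continuous_bromwich_integrand hg' hc x t).aestronglyMeasurable
    (Eventually.of_forall fun w s hs => ?_) ((integrable_inv_one_add_sq.const_mul B).const_mul _)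
    (F' := fun s w => Complex.exp (verticalLine c w * x) *
      (Complex.exp (-s * laplaceExponent lam ν (verticalLine c w)) *
        (-laplaceExponent lam ν (verticalLine c w) * g (verticalLine c w))))
    (Eventually.of_forall fun w s _ => ?_)).2
  · rw [norm_mul, norm_exp_verticalLine_mul]
    exact mul_le_mul_of_nonneg_left (hB s (le_of_lt hs) w) (Real.exp_nonneg _)
  · have h1 : HasDerivAt (fun s : ℝ => -(s : ℂ) * laplaceExponent lam ν (verticalLine c w))
        (-1 * laplaceExponent lam ν (verticalLine c w)) s :=
      (Complex.ofRealCLM.hasDerivAt (x := s)).neg.mul_const _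
    exact ((h1.cexp.mul_const _).const_mul _).congr_deriv (by ring)

theorem continuousAt_bromwich (hm : 1 ≤ m) (hlam : ∀ j, 0 < lam j)
    (hν : ∀ j, ν j ∈ Ioo (0 : ℝ) 1) (hg : PolyGrowth g) (hc : 0 < c) {p : ℝ × ℝ} (hp : 0 < p.2) :
    ContinuousAt (fun q : ℝ × ℝ => bromwich lam ν c g q.1 q.2) p := by
  obtain ⟨B, hB⟩ := exists_bromwich_dominated hm hlam hν hg hc (half_pos hp)
  refine continuousAt_of_dominated
    (bound := fun w => Real.exp (c * (p.1 + 1)) * (B * (1 + w ^ 2)⁻¹))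
    (Eventually.of_forall fun q =>
      (continuous_bromwich_integrand hg hc q.1 q.2).aestronglyMeasurable) ?_
    ((integrable_inv_one_add_sq.const_mul B).const_mul _) (Eventually.of_forall fun w => ?_)
  · have h1 : ∀ᶠ q : ℝ × ℝ in 𝓝 p, q.1 < p.1 + 1 :=
      continuous_fst.continuousAt.eventually_lt_const (lt_add_one _)
    have h2 : ∀ᶠ q : ℝ × ℝ in 𝓝 p, p.2 / 2 < q.2 :=
      continuous_snd.continuousAt.eventually_const_lt (half_lt_self hp)
    filter_upwards [h1, h2] with q hq1 hq2
    refine Eventually.of_forall fun w => ?_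
    rw [norm_mul, norm_exp_verticalLine_mul]
    have := hB q.2 hq2.le w
    gcongr
  · fun_prop

end

/-! ### Fractional calculus of Bromwich integrals -/

/-- Euler's integral for the complex exponent `z`, by continuation from the positive reals. -/
theorem integral_cexp_mul_rpow_neg {a : ℝ} (ha : a < 1) {z : ℂ} (hz : 0 < z.re) :
    ∫ r in Ioi (0 : ℝ), Complex.exp (-z * r) * ((r ^ (-a) : ℝ) : ℂ) =
      Real.Gamma (1 - a) * z ^ ((a - 1 : ℝ) : ℂ) := by
  refine eqOn_re_pos_of_eq_ofReal
    (F := fun z => ∫ r in Ioi (0 : ℝ), Complex.exp (-z * r) * ((r ^ (-a) : ℝ) : ℂ))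
    (G := fun z => Real.Gamma (1 - a) * z ^ ((a - 1 : ℝ) : ℂ)) ?_ ?_ ?_ hz
  · refine differentiableOn_laplace
      ((ae_restrict_mem measurableSet_Ioi).mono fun x hx => le_of_lt hx) fun μ hμ => ?_
    have := (integrableOn_exp_mul_rpow_neg ha hμ).ofReal (𝕜 := ℂ)
    simpa using this
  · intro z hz
    exact (((hasDerivAt_id z).cpow_const
      (mem_slitPlane_of_re_pos hz)).const_mul _).differentiableAt.differentiableWithinAt
  · intro μ hμ
    have h := integral_exp_mul_rpow_neg ha hμ
    have hG : Real.Gamma (1 - a) ≠ 0 := (Real.Gamma_pos_of_pos (by linarith)).ne'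
    simp only [← mul_div_assoc] at h
    rw [integral_div, div_eq_iff hG, mul_comm] at h
    rw [← Complex.ofReal_cpow hμ.le, ← Complex.ofReal_mul, ← h, ← integral_complex_ofReal]
    congr 1 with r
    push_cast
    rfl

section

variable {m : ℕ} {lam ν : Fin m → ℝ} {g : ℂ → ℂ} {c : ℝ}

theorem bromwich_congr {g' : ℂ → ℂ} (hc : 0 < c) (h : ∀ z : ℂ, 0 < z.re → g z = g' z) (x t : ℝ) :
    bromwich lam ν c g x t = bromwich lam ν c g' x t := by
  unfold bromwich
  congr 1 with w
  rw [h _ (by simpa using hc)]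

/-- The Weyl integral over a half-line multiplies the symbol of a Bromwich integral by
`z ^ (a - 1)`. -/
theorem integral_bromwich_mul_rpow_neg (hm : 1 ≤ m) (hlam : ∀ j, 0 < lam j)
    (hν : ∀ j, ν j ∈ Ioo (0 : ℝ) 1) (hg : PolyGrowth g) (hc : 0 < c) {a : ℝ} (ha : a < 1) (x : ℝ)
    {t : ℝ} (ht : 0 < t) :
    IntegrableOn (fun r : ℝ => bromwich lam ν c g (x - r) t * ((r ^ (-a) : ℝ) : ℂ)) (Ioi 0) ∧
      ∫ r in Ioi (0 : ℝ), bromwich lam ν c g (x - r) t * ((r ^ (-a) : ℝ) : ℂ) =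
        Real.Gamma (1 - a) * bromwich lam ν c (fun z => z ^ ((a - 1 : ℝ) : ℂ) * g z) x t := by
  set A : ℝ → ℂ := fun w => Complex.exp (verticalLine c w * x) *
    (Complex.exp (-t * laplaceExponent lam ν (verticalLine c w)) * g (verticalLine c w)) with hA
  have hAi : Integrable A := integrable_bromwich hm hlam hν hg hc x ht
  have hAc : Continuous A := continuous_bromwich_integrand hg hc x t
  set F : ℝ → ℝ → ℂ := fun w r =>
    A w * (Complex.exp (-verticalLine c w * r) * ((r ^ (-a) : ℝ) : ℂ)) with hF
  have hFm : AEStronglyMeasurable (Function.uncurry F) (volume.prod (volume.restrict (Ioi 0))) := by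
    refine Measurable.aestronglyMeasurable ?_
    have h1 : Measurable fun p : ℝ × ℝ => A p.1 := hAc.measurable.comp measurable_fst
    have h2 : Measurable fun p : ℝ × ℝ => Complex.exp (-verticalLine c p.1 * p.2) := by
      have := continuous_verticalLine c
      exact Continuous.measurable (by fun_prop)
    have h3 : Measurable fun p : ℝ × ℝ => ((p.2 ^ (-a) : ℝ) : ℂ) := by fun_prop
    exact h1.mul (h2.mul h3)
  have hFi : Integrable (Function.uncurry F) (volume.prod (volume.restrict (Ioi 0))) := by
    refine (hAi.mul_prod ((integrableOn_exp_mul_rpow_neg ha hc).ofReal (𝕜 := ℂ))).mono hFm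
      (Eventually.of_forall fun p => le_of_eq ?_)
    rcases p with ⟨w, r⟩
    simp [Function.uncurry, hF, Complex.norm_exp]
  have hin : ∀ r, ∫ w, F w r = bromwich lam ν c g (x - r) t * ((r ^ (-a) : ℝ) : ℂ) := fun r => by
    rw [bromwich, ← integral_mul_const]
    congr 1 with w
    simp only [hF, hA]
    rw [show verticalLine c w * ((x - r : ℝ) : ℂ) =
      verticalLine c w * x + -verticalLine c w * r by push_cast; ring, Complex.exp_add]
    ring
  constructor
  · have := hFi.integral_prod_right
    simpa only [Function.uncurry, hin, IntegrableOn] using this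
  · have := integral_integral_swap hFi
    simp only [hin] at this
    rw [← this, bromwich, ← integral_const_mul]
    congr 1 with w
    simp only [hF, integral_const_mul, hA]
    rw [integral_cexp_mul_rpow_neg ha (by simpa using hc)]
    ring

/-- For a Bromwich integral that vanishes on `(-∞, 0]` the Weyl integral is the fractional integral
with base point `0`, and it again vanishes on `(-∞, 0]`. -/
theorem fracIntegral_bromwich (hm : 1 ≤ m) (hlam : ∀ j, 0 < lam j)
    (hν : ∀ j, ν j ∈ Ioo (0 : ℝ) 1) (hg : PolyGrowth g) (hc : 0 < c) {a : ℝ} (ha : a < 1)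
    {t : ℝ} (ht : 0 < t) (h0 : ∀ y ≤ 0, (bromwich lam ν c g y t).re = 0) :
    (∀ x, 0 ≤ x → fracIntegral a (fun y => (bromwich lam ν c g y t).re) x =
      (bromwich lam ν c (fun z => z ^ ((a - 1 : ℝ) : ℂ) * g z) x t).re) ∧
    ∀ x ≤ 0, (bromwich lam ν c (fun z => z ^ ((a - 1 : ℝ) : ℂ) * g z) x t).re = 0 := by
  have hG : 0 < Real.Gamma (1 - a) := Real.Gamma_pos_of_pos (by linarith)
  have key : ∀ x, ∫ r in Ioi (0 : ℝ), (bromwich lam ν c g (x - r) t).re * r ^ (-a) =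
      Real.Gamma (1 - a) *
        (bromwich lam ν c (fun z => z ^ ((a - 1 : ℝ) : ℂ) * g z) x t).re := fun x => by
    obtain ⟨h1, h2⟩ := integral_bromwich_mul_rpow_neg hm hlam hν hg hc ha x ht
    have h3 := integral_re h1
    rw [h2] at h3
    simpa using h3
  constructor
  · intro x hx
    have e1 := setIntegral_eq_of_subset_of_forall_sdiff_eq_zero (μ := volume) (t := Ioi (0 : ℝ))
      (s := Ioc 0 x) (f := fun r => (bromwich lam ν c g (x - r) t).re * r ^ (-a))
      measurableSet_Ioi Ioc_subset_Ioi_self fun r hr => by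
        have : x < r := by
          by_contra hcon
          exact hr.2 ⟨hr.1, not_lt.1 hcon⟩
        rw [h0 _ (by linarith), zero_mul]
    have e2 := intervalIntegral.integral_comp_sub_left (a := 0) (b := x)
      (fun s => (bromwich lam ν c g s t).re / (x - s) ^ a) x
    rw [sub_zero, sub_self] at e2
    rw [fracIntegral, one_div, inv_mul_eq_iff_eq_mul₀ hG.ne', ← key, e1, ← e2,
      ← intervalIntegral.integral_of_le hx]
    refine intervalIntegral.integral_congr fun r hr => ?_
    rw [uIcc_of_le hx] at hr
    simp only [sub_sub_cancel]
    rw [Real.rpow_neg hr.1, div_eq_mul_inv]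
  · intro x hx
    have h1 := key x
    rw [setIntegral_eq_zero_of_forall_eq_zero (fun r hr => by
      have hr : 0 < r := hr
      rw [h0 _ (by linarith), zero_mul])] at h1
    exact (mul_eq_zero.1 h1.symm).resolve_left hG.ne'

theorem continuous_bromwich_re (hm : 1 ≤ m) (hlam : ∀ j, 0 < lam j)
    (hν : ∀ j, ν j ∈ Ioo (0 : ℝ) 1) (hg : PolyGrowth g) (hc : 0 < c) {t : ℝ} (ht : 0 < t) :
    Continuous fun x => (bromwich lam ν c g x t).re :=
  Complex.continuous_re.comp (continuous_iff_continuousAt.2 fun x =>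
    (hasDerivAt_bromwich_space hm hlam hν hg hc x ht).continuousAt)

theorem HasDerivAt.complex_re {f : ℝ → ℂ} {f' : ℂ} {x : ℝ} (h : HasDerivAt f f' x) :
    HasDerivAt (fun y => (f y).re) f'.re x :=
  Complex.reCLM.hasFDerivAt.comp_hasDerivAt x h

/-- The Riemann–Liouville derivative of order `a` multiplies the symbol by `z ^ a`. -/
theorem hasRLDerivAt_bromwich (hm : 1 ≤ m) (hlam : ∀ j, 0 < lam j)
    (hν : ∀ j, ν j ∈ Ioo (0 : ℝ) 1) (hg : PolyGrowth g) (hc : 0 < c) {a : ℝ}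
    (ha : a < 1) {t : ℝ} (ht : 0 < t) (h0 : ∀ y ≤ 0, (bromwich lam ν c g y t).re = 0) {x : ℝ}
    (hx : 0 < x) :
    HasRLDerivAt a (fun y => (bromwich lam ν c g y t).re)
      (bromwich lam ν c (fun z => z ^ (a : ℂ) * g z) x t).re x := by
  constructor
  · filter_upwards [Ioi_mem_nhds hx] with y hy
    have hy : 0 < y := hy
    have hki : IntervalIntegrable (fun s : ℝ => (y - s) ^ (-a)) volume 0 y := by
      have := (intervalIntegral.intervalIntegrable_rpow' (a := y) (b := 0) (r := -a)
        (by linarith)).comp_sub_left y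
      simpa using this
    refine (hki.continuousOn_mul
      (continuous_bromwich_re hm hlam hν hg hc ht).continuousOn).congr fun s hs => ?_
    rw [uIoc_of_le hy.le] at hs
    rw [Real.rpow_neg (by linarith [hs.2]), div_eq_mul_inv]
  · have h1 := (hasDerivAt_bromwich_space hm hlam hν
      ((PolyGrowth.cpow (a - 1)).mul hg) hc x ht).complex_re
    rw [bromwich_congr (g' := fun z => z ^ (a : ℂ) * g z) hc (fun z hz => ?_)] at h1
    · refine h1.congr_of_eventuallyEq ?_
      filter_upwards [Ioi_mem_nhds hx] with y hy
      exact (fracIntegral_bromwich hm hlam hν hg hc ha ht h0).1 y (le_of_lt hy)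
    · have hz0 : z ≠ 0 := Complex.slitPlane_ne_zero (mem_slitPlane_of_re_pos hz)
      rw [Complex.ofReal_sub, Complex.ofReal_one, Complex.cpow_sub _ _ hz0, Complex.cpow_one]
      field_simp

/-! ### Decay away from the origin at small times -/

/-- Integration by parts on the vertical line: multiplication by `x` differentiates the symbol. -/
theorem mul_bromwich (hm : 1 ≤ m) (hlam : ∀ j, 0 < lam j)
    (hν : ∀ j, ν j ∈ Ioo (0 : ℝ) 1) {g' : ℂ → ℂ} (hg : PolyGrowth g) (hg' : PolyGrowth g')
    (hd : ∀ z : ℂ, 0 < z.re → HasDerivAt g (g' z) z) (hc : 0 < c) (x : ℝ) {t : ℝ} (ht : 0 < t) :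
    x * bromwich lam ν c g x t = bromwich lam ν c (fun z =>
      t * laplaceExponent (fun j => lam j * ν j) (fun j => ν j - 1) z * g z + -g' z) x t := by
  set Ψ' := laplaceExponent (fun j => lam j * ν j) (fun j => ν j - 1) with hΨ'
  have hG : PolyGrowth fun z => t * Ψ' z * g z + -g' z :=
    (((PolyGrowth.const _).mul (PolyGrowth.laplaceExponent _ _)).mul hg).add hg'.neg
  have hline : ∀ w, HasDerivAt (verticalLine c) (2 * Real.pi * Complex.I) w := fun w => by
    have : HasDerivAt (fun w : ℝ => (c : ℂ) + 2 * Real.pi * w * Complex.I)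
        (2 * Real.pi * 1 * Complex.I) w :=
      (((Complex.ofRealCLM.hasDerivAt (x := w)).const_mul (2 * Real.pi : ℂ)).mul_const
        Complex.I).const_add _
    exact this.congr_deriv (by ring)
  have hu : ∀ w, HasDerivAt (fun w => Complex.exp (verticalLine c w * x))
      (2 * Real.pi * Complex.I * x * Complex.exp (verticalLine c w * x)) w := fun w =>
    ((hline w).mul_const _).cexp.congr_deriv (by ring)
  have hv : ∀ w, HasDerivAt (fun w => Complex.exp (-t * laplaceExponent lam ν (verticalLine c w)) *
      g (verticalLine c w)) (-(2 * Real.pi * Complex.I) *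
        (Complex.exp (-t * laplaceExponent lam ν (verticalLine c w)) *
          (t * Ψ' (verticalLine c w) * g (verticalLine c w) + -g' (verticalLine c w)))) w := by
    intro w
    have hz : 0 < (verticalLine c w).re := by simpa using hc
    have h1 : HasDerivAt (fun w => laplaceExponent lam ν (verticalLine c w))
        (Ψ' (verticalLine c w) * (2 * Real.pi * Complex.I)) w :=
      (hasDerivAt_laplaceExponent lam ν hz).comp w (hline w)
    have h2 : HasDerivAt (fun w => g (verticalLine c w))
        (g' (verticalLine c w) * (2 * Real.pi * Complex.I)) w := (hd _ hz).comp w (hline w)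
    exact ((h1.const_mul (-t : ℂ)).cexp.mul h2).congr_deriv (by ring)
  have hI : (2 * Real.pi * Complex.I : ℂ) ≠ 0 := Complex.two_pi_I_ne_zero
  have h1 := integrable_bromwich hm hlam hν hG hc x ht
  have h2 := integrable_bromwich hm hlam hν hg hc x ht
  have key := integral_mul_deriv_eq_deriv_mul_of_integrable (fun w _ => hu w) (fun w _ => hv w)
    ((h1.const_mul (-(2 * Real.pi * Complex.I))).congr
      (Eventually.of_forall fun w => by simp only [Pi.mul_apply]; ring))
    ((h2.const_mul (2 * Real.pi * Complex.I * x)).congr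
      (Eventually.of_forall fun w => by simp only [Pi.mul_apply]; ring)) h2
  refine mul_left_cancel₀ hI ?_
  have e1 : 2 * Real.pi * Complex.I * (x * bromwich lam ν c g x t) =
      ∫ w : ℝ, 2 * Real.pi * Complex.I * x * Complex.exp (verticalLine c w * x) *
        (Complex.exp (-t * laplaceExponent lam ν (verticalLine c w)) * g (verticalLine c w)) := by
    rw [bromwich, ← mul_assoc, ← integral_const_mul]
    congr 1 with w
    ring
  have e2 : 2 * Real.pi * Complex.I * bromwich lam ν c (fun z => t * Ψ' z * g z + -g' z) x t =
      -∫ w : ℝ, Complex.exp (verticalLine c w * x) * (-(2 * Real.pi * Complex.I) *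
        (Complex.exp (-t * laplaceExponent lam ν (verticalLine c w)) *
          (t * Ψ' (verticalLine c w) * g (verticalLine c w) + -g' (verticalLine c w)))) := by
    rw [bromwich, ← integral_const_mul, ← integral_neg]
    congr 1 with w
    ring
  rw [e1, e2, key, neg_neg]

/-- Two integrations by parts give `x² h(x, t) = O(t)`, locally uniformly in `x`. The second
derivative of `e^{-tΨ}` is `t` times a function that is `O(|z| ^ (ν - 2))` uniformly in `t`, because
`t |z| ^ ν_j` is absorbed by the decay of `e^{-tΨ}`. -/
theorem exists_sq_mul_norm_bromwich_le (hm : 1 ≤ m) (hlam : ∀ j, 0 < lam j)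
    (hν : ∀ j, ν j ∈ Ioo (0 : ℝ) 1) :
    ∃ C, ∀ t, 0 < t → ∀ x, x ^ 2 * ‖bromwich lam ν 1 (fun _ => 1) x t‖ ≤ C * t * Real.exp x := by
  set Ψ' := laplaceExponent (fun j => lam j * ν j) (fun j => ν j - 1) with hΨ'
  set Ψ'' := laplaceExponent (fun j => lam j * ν j * (ν j - 1)) (fun j => ν j - 1 - 1) with hΨ''
  set D := ∑ j, lam j * ν j / decayRate lam ν j with hD
  have hκ := decayRate_pos hlam hν
  have hD0 : 0 ≤ D := Finset.sum_nonneg fun j _ =>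
    div_nonneg (mul_nonneg (hlam j).le (hν j).1.le) (hκ j).le
  set b : ℝ → ℝ := fun w => ∑ j, lam j * ν j * (1 + ‖w‖ ^ 2) ^ (-(2 - ν j) / 2) with hb
  have hbi : Integrable b := integrable_finsetSum _ fun j _ =>
    (integrable_rpow_neg_one_add_norm_sq (E := ℝ) (r := 2 - ν j)
      (by simp; linarith [(hν j).2])).const_mul _
  have hpt : ∀ t : ℝ, 0 < t → ∀ w, ‖Complex.exp (-t * laplaceExponent lam ν (verticalLine 1 w)) *
      (t * Ψ' (verticalLine 1 w) * (t * Ψ' (verticalLine 1 w)) + -(t * Ψ'' (verticalLine 1 w)))‖ ≤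
        (D + 1) * t * b w := by
    intro t ht w
    set z := verticalLine 1 w with hz
    have hzre : z.re = 1 := verticalLine_re 1 w
    have hz0 : 0 < ‖z‖ := norm_pos_iff.2 fun h => by simp [h] at hzre
    set S := ∑ j, lam j * ν j * ‖z‖ ^ (ν j - 2) with hS
    have hS1 : ∑ j, lam j * ν j * ‖z‖ ^ (ν j - 1) = S * ‖z‖ := by
      rw [hS, Finset.sum_mul]
      refine Finset.sum_congr rfl fun j _ => ?_
      rw [mul_assoc (lam j * ν j), ← Real.rpow_add_one hz0.ne']
      ring_nf
    have hA : ‖Ψ' z‖ ≤ S * ‖z‖ := by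
      rw [← hS1]
      refine (norm_laplaceExponent_le _ _ z).trans (le_of_eq (Finset.sum_congr rfl fun j _ => ?_))
      rw [abs_of_nonneg (mul_nonneg (hlam j).le (hν j).1.le)]
    have hB : ‖Ψ'' z‖ ≤ S := by
      refine (norm_laplaceExponent_le _ _ z).trans (Finset.sum_le_sum fun j _ => ?_)
      have h1 := mul_nonneg (hlam j).le (hν j).1.le
      rw [abs_mul, abs_of_nonneg h1, abs_of_neg (by linarith [(hν j).2]),
        show ν j - 1 - 1 = ν j - 2 by ring]
      have h2 : lam j * ν j * -(ν j - 1) ≤ lam j * ν j := by nlinarith [(hν j).1]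
      gcongr
    set E := ‖Complex.exp (-t * laplaceExponent lam ν z)‖ with hE
    have hE1 : E ≤ 1 := by
      refine (norm_exp_neg_mul_laplaceExponent_le hlam hν ⟨0, hm⟩ (by linarith) ht.le).trans ?_
      rw [Real.exp_le_one_iff, neg_mul]
      have := hκ ⟨0, hm⟩
      exact neg_nonpos.2 (by positivity)
    have hEj : ∀ j, E * (t * ‖z‖ ^ ν j) ≤ 1 / decayRate lam ν j := fun j => by
      have h1 := norm_exp_neg_mul_laplaceExponent_le hlam hν j (z := z) (by linarith) ht.le
      rw [le_div_iff₀ (hκ j)]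
      set q := t * decayRate lam ν j * ‖z‖ ^ ν j with hq
      have hq0 : 0 ≤ q := by have := hκ j; positivity
      have h2 : q ≤ Real.exp q := by linarith [Real.add_one_le_exp q]
      calc E * (t * ‖z‖ ^ ν j) * decayRate lam ν j = E * q := by rw [hq]; ring
        _ ≤ Real.exp (-q) * q := by
          refine mul_le_mul_of_nonneg_right (h1.trans (le_of_eq ?_)) hq0
          rw [hq]; ring_nf
        _ ≤ Real.exp (-q) * Real.exp q := by gcongr
        _ = 1 := by rw [← Real.exp_add]; simp
    have hED : E * (t * (S * ‖z‖)) * ‖z‖ ≤ D := by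
      rw [← hS1, hD, Finset.mul_sum, Finset.mul_sum, Finset.sum_mul]
      refine Finset.sum_le_sum fun j _ => ?_
      have h1 := mul_nonneg (hlam j).le (hν j).1.le
      calc E * (t * (lam j * ν j * ‖z‖ ^ (ν j - 1))) * ‖z‖
          = lam j * ν j * (E * (t * ‖z‖ ^ ν j)) := by
            rw [Real.rpow_sub_one hz0.ne']; field_simp
        _ ≤ lam j * ν j * (1 / decayRate lam ν j) := by
            have := hEj j
            gcongr
        _ = _ := by ring
    have hSb : S ≤ b w := by
      refine Finset.sum_le_sum fun j _ => ?_
      have h1 := mul_nonneg (hlam j).le (hν j).1.le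
      refine mul_le_mul_of_nonneg_left ?_ h1
      have h2 : 1 + ‖w‖ ^ 2 ≤ ‖z‖ ^ 2 := by
        have e : z.im = 2 * Real.pi * w := by simp [hz, verticalLine]
        rw [← Complex.normSq_eq_norm_sq, Complex.normSq_apply, hzre, e, Real.norm_eq_abs, sq_abs]
        nlinarith [Real.pi_gt_three, mul_nonneg (sq_nonneg w) (sq_nonneg (Real.pi - 1)),
          sq_nonneg w]
      calc ‖z‖ ^ (ν j - 2) = (‖z‖ ^ 2) ^ (-(2 - ν j) / 2) := by
            rw [← Real.rpow_natCast, ← Real.rpow_mul hz0.le]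
            congr 1
            push_cast
            ring
        _ ≤ _ := Real.rpow_le_rpow_of_nonpos (by positivity) h2 (by linarith [(hν j).2])
    have hS0 : 0 ≤ S := Finset.sum_nonneg fun j _ =>
      mul_nonneg (mul_nonneg (hlam j).le (hν j).1.le) (by positivity)
    have ht' : ‖(t : ℂ)‖ = t := by rw [Complex.norm_real, Real.norm_of_nonneg ht.le]
    calc _ ≤ E * (t * (S * ‖z‖) * (t * (S * ‖z‖)) + t * S) := by
          rw [norm_mul]
          refine mul_le_mul_of_nonneg_left ?_ (norm_nonneg _)
          refine (norm_add_le _ _).trans ?_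
          rw [norm_neg, norm_mul, norm_mul, norm_mul, ht']
          gcongr
      _ = E * (t * (S * ‖z‖)) * ‖z‖ * (t * S) + E * (t * S) := by ring
      _ ≤ D * (t * S) + 1 * (t * S) := by gcongr
      _ = (D + 1) * t * S := by ring
      _ ≤ _ := by gcongr
  refine ⟨(D + 1) * ∫ w, b w, fun t ht x => ?_⟩
  have hΨ'p : PolyGrowth Ψ' := PolyGrowth.laplaceExponent _ _
  have hΨ''p : PolyGrowth Ψ'' := PolyGrowth.laplaceExponent _ _
  have e1 : x * bromwich lam ν 1 (fun _ => 1) x t = bromwich lam ν 1 (fun z => t * Ψ' z) x t := by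
    rw [mul_bromwich hm hlam hν (PolyGrowth.const 1) (PolyGrowth.const 0)
      (fun z _ => hasDerivAt_const z 1) one_pos x ht]
    simp [hΨ']
  have e2 := mul_bromwich hm hlam hν ((PolyGrowth.const (t : ℂ)).mul hΨ'p)
    ((PolyGrowth.const (t : ℂ)).mul hΨ''p)
    (fun z hz => (hasDerivAt_laplaceExponent _ _ hz).const_mul (t : ℂ)) one_pos x ht
  rw [← e1] at e2
  have e3 : x ^ 2 * ‖bromwich lam ν 1 (fun _ => 1) x t‖ =
      ‖(x : ℂ) * (x * bromwich lam ν 1 (fun _ => 1) x t)‖ := by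
    rw [norm_mul, norm_mul, Complex.norm_real, ← mul_assoc, Real.norm_eq_abs, abs_mul_abs_self, sq]
  rw [e3, e2, bromwich]
  calc _ ≤ ∫ w, Real.exp x * ((D + 1) * t * b w) := by
        refine norm_integral_le_of_norm_le ((hbi.const_mul _).const_mul _)
          (Eventually.of_forall fun w => ?_)
        rw [norm_mul, norm_exp_verticalLine_mul, one_mul]
        exact mul_le_mul_of_nonneg_left (hpt t ht w) (Real.exp_nonneg _)
    _ = _ := by rw [integral_const_mul, integral_const_mul]; ring

end

/-! ### The law of the weighted sum at a fixed time -/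

/-- `ρ` is a probability law on `[0, ∞)` with Laplace transform `e^{-tΨ}`. -/
structure IsSubordinatorLaw {m : ℕ} (lam ν : Fin m → ℝ) (t : ℝ) (ρ : Measure ℝ) : Prop where
  prob : IsProbabilityMeasure ρ
  nonneg : ∀ᵐ x ∂ρ, 0 ≤ x
  laplace : ∀ μ : ℝ, 0 < μ →
    ∫ x, Real.exp (-μ * x) ∂ρ = Real.exp (-t * ∑ j, lam j * μ ^ ν j)

section

variable {m : ℕ} {lam ν : Fin m → ℝ} {ρ : Measure ℝ} {t : ℝ}

theorem IsSubordinatorLaw.integrable (h : IsSubordinatorLaw lam ν t ρ) {μ : ℝ} (hμ : 0 ≤ μ) :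
    Integrable (fun x => Real.exp (-μ * x)) ρ := by
  have := h.prob
  refine (integrable_const (1 : ℝ)).mono' (by fun_prop) ?_
  filter_upwards [h.nonneg] with x hx
  rw [Real.norm_of_nonneg (Real.exp_nonneg _), Real.exp_le_one_iff, neg_mul]
  exact neg_nonpos.2 (by positivity)

theorem IsSubordinatorLaw.laplace_complex (h : IsSubordinatorLaw lam ν t ρ) {z : ℂ}
    (hz : 0 < z.re) :
    ∫ x, Complex.exp (-z * x) ∂ρ = Complex.exp (-t * laplaceExponent lam ν z) := by
  have hD : DifferentiableOn ℂ (fun z => ∫ x, Complex.exp (-z * x) * (1 : ℂ) ∂ρ)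
      {z | 0 < z.re} := by
    refine differentiableOn_laplace h.nonneg fun μ hμ => ?_
    simpa using (h.integrable hμ.le).ofReal (𝕜 := ℂ)
  simp only [mul_one] at hD
  refine eqOn_re_pos_of_eq_ofReal hD
    ((differentiableOn_laplaceExponent lam ν).const_mul (-t : ℂ)).cexp (fun μ hμ => ?_) hz
  rw [laplaceExponent_ofReal lam ν hμ.le]
  have := h.laplace μ hμ
  rw [← Complex.ofReal_inj, ← integral_complex_ofReal] at this
  push_cast at this ⊢
  exact this

open scoped FourierTransform in
/-- Fourier inversion for the exponentially tilted law `e^{-cx} ρ(dx)`, whose Fourier transform is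
`e^{-tΨ}` on the line `Re z = c`, shows that `ρ` has the Bromwich integral as its density. -/
theorem IsSubordinatorLaw.density (h : IsSubordinatorLaw lam ν t ρ) (hm : 1 ≤ m)
    (hlam : ∀ j, 0 < lam j) (hν : ∀ j, ν j ∈ Ioo (0 : ℝ) 1) (ht : 0 < t) {c : ℝ} (hc : 0 < c) :
    (∀ x, 0 ≤ (bromwich lam ν c (fun _ => 1) x t).re) ∧
      ρ = volume.withDensity fun x => ENNReal.ofReal (bromwich lam ν c (fun _ => 1) x t).re := by
  have := h.prob
  set ρ' := ρ.withDensity fun x => ENNReal.ofReal (Real.exp (-c * x)) with hρ'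
  have hfin : IsFiniteMeasure ρ' := isFiniteMeasure_withDensity_ofReal (h.integrable hc.le).2
  set ψ : ℝ → ℂ := fun w => Complex.exp (-t * laplaceExponent lam ν (verticalLine c w)) with hψ
  have hψρ : ∀ w, ψ w = ∫ u, Complex.exp (-(2 * Real.pi * w * u) * Complex.I) ∂ρ' := fun w => by
    rw [hρ', integral_withDensity_eq_integral_toReal_smul (by fun_prop) (by simp),
      show ψ w = Complex.exp (-t * laplaceExponent lam ν (verticalLine c w)) from rfl,
      ← h.laplace_complex (by simpa using hc)]
    congr 1 with u
    rw [ENNReal.toReal_ofReal (Real.exp_nonneg _), Complex.real_smul, Complex.ofReal_exp,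
      ← Complex.exp_add, verticalLine]
    congr 1
    push_cast
    ring
  have hψi : Integrable ψ := by
    simpa [hψ] using integrable_exp_mul hm hlam hν (PolyGrowth.const 1) hc ht
  have hψc : Continuous ψ := by
    simpa [hψ] using continuous_bromwich_integrand (lam := lam) (ν := ν) (PolyGrowth.const 1) hc 0 t
  obtain ⟨h1, h2⟩ := fourierInv_density hψρ hψc hψi
  have hb : ∀ x, bromwich lam ν c (fun _ => 1) x t = Real.exp (c * x) * 𝓕⁻ ψ x := fun x => by
    rw [bromwich, Real.fourierInv_eq', ← integral_const_mul]
    congr 1 with w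
    change Complex.exp (verticalLine c w * x) * (ψ w * 1) = _
    rw [mul_one, smul_eq_mul, ← mul_assoc]
    congr 1
    rw [Complex.ofReal_exp, ← Complex.exp_add]
    congr 1
    simp [verticalLine]
    ring
  have hbr : ∀ x, (bromwich lam ν c (fun _ => 1) x t).re = Real.exp (c * x) * (𝓕⁻ ψ x).re :=
    fun x => by rw [hb, Complex.re_ofReal_mul]
  have hcont := continuous_bromwich_re hm hlam hν (PolyGrowth.const 1) hc ht
  have hFm : Measurable fun x => ENNReal.ofReal (𝓕⁻ ψ x).re := by
    have e : ∀ x, (𝓕⁻ ψ x).re = Real.exp (-(c * x)) * (bromwich lam ν c (fun _ => 1) x t).re :=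
      fun x => by rw [hbr, ← mul_assoc, ← Real.exp_add]; simp
    simp only [e]
    exact Measurable.ennreal_ofReal (Continuous.measurable (by fun_prop))
  refine ⟨fun x => by rw [hbr]; exact mul_nonneg (Real.exp_nonneg _) (h1 x), ?_⟩
  have e1 : ρ = ρ'.withDensity fun x => ENNReal.ofReal (Real.exp (c * x)) := by
    rw [hρ', ← withDensity_mul _ (by fun_prop) (by fun_prop)]
    convert withDensity_one.symm using 2
    ext x
    simp only [Pi.mul_apply, Pi.one_apply]
    rw [← ENNReal.ofReal_mul (Real.exp_nonneg _), ← Real.exp_add]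
    simp
  rw [e1, h2, ← withDensity_mul _ hFm (by fun_prop)]
  congr 1 with x
  simp only [Pi.mul_apply]
  rw [hbr, ← ENNReal.ofReal_mul (h1 x), mul_comm]

/-- Densities of the same law, the Bromwich integrals over different lines agree; no contour is
moved. -/
theorem IsSubordinatorLaw.bromwich_one_indep (h : IsSubordinatorLaw lam ν t ρ) (hm : 1 ≤ m)
    (hlam : ∀ j, 0 < lam j) (hν : ∀ j, ν j ∈ Ioo (0 : ℝ) 1) (ht : 0 < t) {c c' : ℝ} (hc : 0 < c)
    (hc' : 0 < c') (x : ℝ) : (bromwich lam ν c (fun _ => 1) x t).re =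
      (bromwich lam ν c' (fun _ => 1) x t).re := by
  obtain ⟨h1, h2⟩ := h.density hm hlam hν ht hc
  obtain ⟨h1', h2'⟩ := h.density hm hlam hν ht hc'
  have hcont := continuous_bromwich_re hm hlam hν (PolyGrowth.const 1) hc ht
  have hcont' := continuous_bromwich_re hm hlam hν (PolyGrowth.const 1) hc' ht
  rw [h2, withDensity_eq_iff_of_sigmaFinite hcont.measurable.ennreal_ofReal.aemeasurable
    hcont'.measurable.ennreal_ofReal.aemeasurable] at h2'
  refine congrFun (Measure.eq_of_ae_eq (μ := volume) ?_ hcont hcont') x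
  filter_upwards [h2'] with y hy
  exact (ENNReal.ofReal_eq_ofReal_iff (h1 y) (h1' y)).1 hy

theorem IsSubordinatorLaw.bromwich_one_eq_zero (h : IsSubordinatorLaw lam ν t ρ) (hm : 1 ≤ m)
    (hlam : ∀ j, 0 < lam j) (hν : ∀ j, ν j ∈ Ioo (0 : ℝ) 1) (ht : 0 < t) {c : ℝ} (hc : 0 < c)
    (x : ℝ) (hx : x ≤ 0) : (bromwich lam ν c (fun _ => 1) x t).re = 0 := by
  obtain ⟨h1, h2⟩ := h.density hm hlam hν ht hc
  have hcont := continuous_bromwich_re hm hlam hν (PolyGrowth.const 1) hc ht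
  have h3 : ρ (Iio 0) = 0 := by
    have := h.nonneg
    rw [ae_iff] at this
    simpa [not_le, Iio] using this
  rw [h2, withDensity_apply _ measurableSet_Iio,
    lintegral_eq_zero_iff hcont.measurable.ennreal_ofReal] at h3
  have h4 : EqOn (fun x => (bromwich lam ν c (fun _ => 1) x t).re) (fun _ => 0) (Iio 0) := by
    refine Measure.eqOn_open_of_ae_eq (μ := volume) ?_ isOpen_Iio hcont.continuousOn
      continuousOn_const
    filter_upwards [h3] with y hy
    exact le_antisymm (ENNReal.ofReal_eq_zero.1 hy) (h1 y)
  have h5 := h4.closure hcont continuous_const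
  rw [closure_Iio] at h5
  exact h5 hx

end

/-! ### Paths of the weighted sum and the first-passage time -/

/-- The first-passage time is the generalised inverse of a right-continuous monotone path. -/
theorem hittingTime_le_iff {Ω : Type*} {X : ℝ≥0 → Ω → ℝ} {ω : Ω} {t x : ℝ} (hX0 : X 0 ω = 0)
    (hmono : Monotone fun s => X s ω)
    (hcont : ∀ s, ContinuousWithinAt (fun s => X s ω) (Ici s) s) (hex : ∃ n : ℕ, t ≤ X n ω)
    (ht : 0 < t) (hx : 0 ≤ x) : hittingTime X t ω ≤ x ↔ t ≤ X x.toNNReal ω := by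
  set S := {s : ℝ | 0 < s ∧ t ≤ X s.toNNReal ω} with hS
  have hne : S.Nonempty := by
    obtain ⟨n, hn⟩ := hex
    refine ⟨n + 1, by positivity, hn.trans (hmono ?_)⟩
    rw [← NNReal.coe_le_coe, Real.coe_toNNReal _ (by positivity)]
    simp
  constructor
  · intro h
    by_contra! hlt
    have h1 : ∀ᶠ s in 𝓝[≥] x.toNNReal, X s ω < t := (hcont x.toNNReal).eventually_lt_const hlt
    have h2 := h1.filter_mono (nhdsWithin_mono _ Ioi_subset_Ici_self)
    obtain ⟨s, hs1, hs2⟩ := (h2.and self_mem_nhdsWithin).exists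
    have hs2 : x < s := by
      have : x.toNNReal < s := hs2
      rwa [← NNReal.coe_lt_coe, Real.coe_toNNReal _ hx] at this
    have h3 : (s : ℝ) ≤ hittingTime X t ω := by
      refine le_csInf hne fun r hr => ?_
      by_contra! hrs
      have : X r.toNNReal ω ≤ X s ω := hmono (Real.toNNReal_le_iff_le_coe.2 hrs.le)
      linarith [hr.2]
    linarith
  · intro h
    have hx' : 0 < x := by
      rcases hx.eq_or_lt with rfl | hx
      · rw [Real.toNNReal_zero, hX0] at h
        linarith
      · exact hx
    exact csInf_le ⟨0, fun r hr => hr.1.le⟩ ⟨hx', h⟩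

theorem hittingTime_nonneg {Ω : Type*} (X : ℝ≥0 → Ω → ℝ) (t : ℝ) (ω : Ω) : 0 ≤ hittingTime X t ω :=
  Real.sInf_nonneg fun _ hs => hs.1.le

section

variable {Ω : Type*} [MeasurableSpace Ω] {P : Measure Ω} {m : ℕ}
  {lam ν : Fin m → ℝ} {H : Fin m → ℝ≥0 → Ω → ℝ}

theorem measurable_weightedSum (hH : ∀ j, IsStableSubordinator P (ν j) (H j)) (t : ℝ≥0) :
    Measurable (weightedSum lam ν H t) := by
  unfold weightedSum
  exact Finset.measurable_fun_sum _ fun j _ => ((hH j).measurable t).const_mul _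

theorem weightedSum_paths (hlam : ∀ j, 0 < lam j) (hH : ∀ j, IsStableSubordinator P (ν j) (H j)) :
    ∀ᵐ ω ∂P, weightedSum lam ν H 0 ω = 0 ∧ Monotone (fun t => weightedSum lam ν H t ω) ∧
      ∀ t, ContinuousWithinAt (fun s => weightedSum lam ν H s ω) (Ici t) t := by
  have h1 : ∀ᵐ ω ∂P, ∀ j, H j 0 ω = 0 := ae_all_iff.2 fun j => (hH j).zero
  have h2 : ∀ᵐ ω ∂P, ∀ j, Monotone (fun t => H j t ω) ∧
      ∀ t, ContinuousWithinAt (fun s => H j s ω) (Ici t) t := ae_all_iff.2 fun j => (hH j).paths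
  filter_upwards [h1, h2] with ω hω1 hω2
  unfold weightedSum
  refine ⟨by simp [hω1], fun s t hst => ?_, fun t => ?_⟩
  · exact Finset.sum_le_sum fun j _ =>
      mul_le_mul_of_nonneg_left ((hω2 j).1 hst) (Real.rpow_nonneg (hlam j).le _)
  · exact tendsto_finsetSum _ fun j _ => ((hω2 j).2 t).const_mul _

/-- By independence the transforms multiply, and the weights `λ_j ^ (1 / ν_j)` turn `μ ^ ν_j` into
`λ_j μ ^ ν_j`. -/
theorem isSubordinatorLaw_weightedSum [IsProbabilityMeasure P] (hlam : ∀ j, 0 < lam j)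
    (hν : ∀ j, ν j ∈ Ioo (0 : ℝ) 1) (hH : ∀ j, IsStableSubordinator P (ν j) (H j))
    (hindep : iIndepFun (fun j (ω : Ω) (t : ℝ≥0) => H j t ω) P) (t : ℝ≥0) :
    IsSubordinatorLaw lam ν t (P.map (weightedSum lam ν H t)) := by
  have hX := measurable_weightedSum (lam := lam) hH t
  refine ⟨Measure.isProbabilityMeasure_map hX.aemeasurable, ?_, fun μ hμ => ?_⟩
  · rw [ae_map_iff hX.aemeasurable measurableSet_Ici]
    filter_upwards [weightedSum_paths hlam hH] with ω hω
    exact hω.1.ge.trans (hω.2.1 zero_le)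
  · rw [integral_map hX.aemeasurable (by fun_prop)]
    have hi : iIndepFun (fun j ω => lam j ^ (1 / ν j) * H j t ω) P :=
      hindep.comp (fun j p => lam j ^ (1 / ν j) * p t) fun j => (measurable_pi_apply t).const_mul _
    have h1 := hi.mgf_sum (t := -μ) (fun j => ((hH j).measurable t).const_mul _) Finset.univ
    have h2 : mgf (∑ j, fun ω => lam j ^ (1 / ν j) * H j t ω) P (-μ) =
        ∫ ω, Real.exp (-μ * weightedSum lam ν H t ω) ∂P := by
      simp only [mgf, weightedSum, Finset.sum_apply]
    rw [← h2, h1, Finset.mul_sum, Real.exp_sum]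
    refine Finset.prod_congr rfl fun j _ => ?_
    have h3 := (hH j).laplace t (μ * lam j ^ (1 / ν j))
      (mul_pos hμ (Real.rpow_pos_of_pos (hlam j) _))
    rw [Real.mul_rpow hμ.le (Real.rpow_nonneg (hlam j).le _), ← Real.rpow_mul (hlam j).le,
      one_div_mul_cancel (hν j).1.ne', Real.rpow_one, mul_comm (μ ^ ν j)] at h3
    rw [← h3, mgf]
    congr 1 with ω
    ring_nf

/-- The weighted sum tends to infinity, by Chernoff's bound. -/
theorem ae_exists_le_weightedSum [IsProbabilityMeasure P] (hm : 1 ≤ m) (hlam : ∀ j, 0 < lam j)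
    (hν : ∀ j, ν j ∈ Ioo (0 : ℝ) 1) (hH : ∀ j, IsStableSubordinator P (ν j) (H j))
    (hindep : iIndepFun (fun j (ω : Ω) (t : ℝ≥0) => H j t ω) P) (t : ℝ) :
    ∀ᵐ ω ∂P, ∃ n : ℕ, t ≤ weightedSum lam ν H n ω := by
  set k := ∑ j, lam j with hk
  have hk0 : 0 < k := Finset.sum_pos (fun j _ => hlam j) ⟨⟨0, hm⟩, Finset.mem_univ _⟩
  have hb : ∀ n : ℕ, P.real {ω | ∀ n : ℕ, weightedSum lam ν H n ω < t} ≤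
      Real.exp t * Real.exp (-n * k) := fun n => by
    have hlaw := isSubordinatorLaw_weightedSum hlam hν hH hindep (n : ℝ≥0)
    have hX := measurable_weightedSum (lam := lam) hH (n : ℝ≥0)
    have hi := (integrable_map_measure (by fun_prop) hX.aemeasurable).1
      (hlaw.integrable zero_le_one)
    have h1 := measure_le_le_exp_mul_mgf (μ := P) (X := weightedSum lam ν H n) t
      (t := -1) (by norm_num) hi
    have h2 : mgf (weightedSum lam ν H n) P (-1) = Real.exp (-n * k) := by
      have := hlaw.laplace 1 one_pos
      rw [integral_map hX.aemeasurable (by fun_prop)] at this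
      simpa [mgf, hk] using this
    rw [h2, neg_neg, one_mul] at h1
    refine le_trans (measureReal_mono fun ω hω => ?_) h1
    exact (hω n).le
  have hlim : Tendsto (fun n : ℕ => Real.exp t * Real.exp (-n * k)) atTop (𝓝 0) := by
    have : Tendsto (fun n : ℕ => -(n : ℝ) * k) atTop atBot := by
      have := tendsto_neg_atTop_atBot.comp
        ((tendsto_natCast_atTop_atTop (R := ℝ)).atTop_mul_const hk0)
      exact this.congr fun n => (neg_mul _ _).symm
    simpa using (Real.tendsto_exp_atBot.comp this).const_mul (Real.exp t)
  have h0 : P.real {ω | ∀ n : ℕ, weightedSum lam ν H n ω < t} = 0 :=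
    le_antisymm (ge_of_tendsto' hlim hb) measureReal_nonneg
  rw [measureReal_eq_zero_iff] at h0
  rw [ae_iff]
  simpa only [not_exists, not_le] using h0

theorem ae_hittingTime_le_iff [IsProbabilityMeasure P] (hm : 1 ≤ m) (hlam : ∀ j, 0 < lam j)
    (hν : ∀ j, ν j ∈ Ioo (0 : ℝ) 1) (hH : ∀ j, IsStableSubordinator P (ν j) (H j))
    (hindep : iIndepFun (fun j (ω : Ω) (t : ℝ≥0) => H j t ω) P) {t : ℝ} (ht : 0 < t) :
    ∀ᵐ ω ∂P, ∀ x, 0 ≤ x →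
      (hittingTime (weightedSum lam ν H) t ω ≤ x ↔ t ≤ weightedSum lam ν H x.toNNReal ω) := by
  filter_upwards [weightedSum_paths hlam hH, ae_exists_le_weightedSum hm hlam hν hH hindep t]
    with ω h1 h2 x hx
  exact hittingTime_le_iff h1.1 h1.2.1 h1.2.2 h2 ht hx

/-- Almost surely the sublevel sets of the first-passage time are sublevel sets of the measurable
variables `weightedSum`, which gives measurability up to null sets only. -/
theorem aemeasurable_hittingTime [IsProbabilityMeasure P] (hm : 1 ≤ m) (hlam : ∀ j, 0 < lam j)
    (hν : ∀ j, ν j ∈ Ioo (0 : ℝ) 1) (hH : ∀ j, IsStableSubordinator P (ν j) (H j))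
    (hindep : iIndepFun (fun j (ω : Ω) (t : ℝ≥0) => H j t ω) P) {t : ℝ} (ht : 0 < t) :
    AEMeasurable (hittingTime (weightedSum lam ν H) t) P := by
  have key : ∀ x, NullMeasurableSet (hittingTime (weightedSum lam ν H) t ⁻¹' Iic x) P := by
    intro x
    rcases lt_or_ge x 0 with hx | hx
    · rw [show hittingTime (weightedSum lam ν H) t ⁻¹' Iic x = ∅ from
        eq_empty_of_forall_notMem fun ω hω =>
          absurd (hittingTime_nonneg (weightedSum lam ν H) t ω) (not_le.2 (lt_of_le_of_lt hω hx))]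
      exact nullMeasurableSet_empty
    · have h1 : MeasurableSet {ω | t ≤ weightedSum lam ν H x.toNNReal ω} :=
        measurableSet_le measurable_const (measurable_weightedSum hH _)
      refine h1.nullMeasurableSet.congr ?_
      filter_upwards [ae_hittingTime_le_iff hm hlam hν hH hindep ht] with ω hω
      exact propext (hω x hx).symm
  exact NullMeasurable.aemeasurable
    (@measurable_of_Iic _ (NullMeasurableSpace Ω P) _ _ _ _ _ _ _ _ key)

theorem map_hittingTime_Iic [IsProbabilityMeasure P] (hm : 1 ≤ m) (hlam : ∀ j, 0 < lam j)
    (hν : ∀ j, ν j ∈ Ioo (0 : ℝ) 1) (hH : ∀ j, IsStableSubordinator P (ν j) (H j))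
    (hindep : iIndepFun (fun j (ω : Ω) (t : ℝ≥0) => H j t ω) P) {t : ℝ} (ht : 0 < t) {x : ℝ}
    (hx : 0 ≤ x) : P.map (hittingTime (weightedSum lam ν H) t) (Iic x) =
      P.map (weightedSum lam ν H x.toNNReal) (Ici t) := by
  rw [Measure.map_apply_of_aemeasurable (aemeasurable_hittingTime hm hlam hν hH hindep ht)
    measurableSet_Iic, Measure.map_apply (measurable_weightedSum hH _) measurableSet_Ici]
  refine measure_congr ?_
  filter_upwards [ae_hittingTime_le_iff hm hlam hν hH hindep ht] with ω hω
  exact propext (hω x hx)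

/-- The paths start at `0` and are right-continuous, so the laws converge weakly to `δ_0`. -/
theorem tendsto_integral_map_weightedSum [IsProbabilityMeasure P] (hlam : ∀ j, 0 < lam j)
    (hH : ∀ j, IsStableSubordinator P (ν j) (H j)) (φ : ℝ →ᵇ ℝ) :
    Tendsto (fun t : ℝ => ∫ x, φ x ∂(P.map (weightedSum lam ν H t.toNNReal))) (𝓝[>] 0)
      (𝓝 (φ 0)) := by
  have h1 : ∀ t : ℝ, ∫ x, φ x ∂(P.map (weightedSum lam ν H t.toNNReal)) =
      ∫ ω, φ (weightedSum lam ν H t.toNNReal ω) ∂P := fun t =>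
    integral_map (measurable_weightedSum hH _).aemeasurable φ.continuous.aestronglyMeasurable
  have h2 : φ 0 = ∫ _, φ 0 ∂P := by simp
  simp only [h1]
  rw [h2]
  refine tendsto_integral_filter_of_dominated_convergence (fun _ => ‖φ‖)
    (Eventually.of_forall fun t => ?_)
    (Eventually.of_forall fun t => Eventually.of_forall fun ω => φ.norm_coe_le_norm _)
    (integrable_const _) ?_
  · exact (φ.continuous.measurable.comp (measurable_weightedSum hH _)).aestronglyMeasurable
  · filter_upwards [weightedSum_paths hlam hH] with ω hω
    have h3 : Tendsto (fun t : ℝ => t.toNNReal) (𝓝[>] 0) (𝓝[≥] 0) := by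
      refine tendsto_nhdsWithin_iff.2 ⟨?_, Eventually.of_forall fun t => mem_Ici.2 zero_le⟩
      exact (continuous_real_toNNReal.tendsto' 0 0 (by simp)).mono_left nhdsWithin_le_nhds
    have h4 := (hω.2.2 0).tendsto.comp h3
    simp only [hω.1] at h4
    exact (φ.continuous.tendsto 0).comp h4

end

/-! ### The densities of the weighted sum and of its inverse -/

/-- The density `h(x, t)` of the weighted sum at time `t`. -/
noncomputable def sumDensity {m : ℕ} (lam ν : Fin m → ℝ) (x t : ℝ) : ℝ :=
  (bromwich lam ν 1 (fun _ => 1) x t).re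

/-- The density `l(x, t)` of the first-passage time over `t`: the inverse Laplace transform in `t`
of `(Ψ(z) / z) e^{-xΨ(z)}` for `x > 0`, and the prescribed boundary value for `x ≤ 0`. -/
noncomputable def inverseDensity {m : ℕ} (lam ν : Fin m → ℝ) (x t : ℝ) : ℝ :=
  if 0 < x then (bromwich lam ν 1 (laplaceExponent lam fun j => ν j - 1) t x).re
  else ∑ j, lam j * (t ^ (-ν j) / Real.Gamma (1 - ν j))

/-- Laws on `[0, ∞)` with Laplace transforms `e^{-tΨ}` that converge weakly to `δ_0` as `t → 0`. -/
structure IsSubordinatorFamily {m : ℕ} (lam ν : Fin m → ℝ) (ρ : ℝ → Measure ℝ) : Prop where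
  law : ∀ t, 0 < t → IsSubordinatorLaw lam ν t (ρ t)
  tendsto : ∀ φ : ℝ →ᵇ ℝ, Tendsto (fun t => ∫ x, φ x ∂(ρ t)) (𝓝[>] 0) (𝓝 (φ 0))

section

variable {m : ℕ} {lam ν : Fin m → ℝ} {ρ : ℝ → Measure ℝ} {g : ℂ → ℂ} {c : ℝ}

theorem bromwich_sum (hm : 1 ≤ m) (hlam : ∀ j, 0 < lam j) (hν : ∀ j, ν j ∈ Ioo (0 : ℝ) 1)
    (a : Fin m → ℝ) {f : Fin m → ℂ → ℂ} (hf : ∀ j, PolyGrowth (f j)) (hc : 0 < c) (x : ℝ) {t : ℝ}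
    (ht : 0 < t) : (bromwich lam ν c (fun z => ∑ j, (a j : ℂ) * f j z) x t).re =
      ∑ j, a j * (bromwich lam ν c (f j) x t).re := by
  have h : bromwich lam ν c (fun z => ∑ j, (a j : ℂ) * f j z) x t =
      ∑ j, (a j : ℂ) * bromwich lam ν c (f j) x t := by
    simp only [bromwich, ← integral_const_mul]
    rw [← integral_finsetSum _ fun j _ =>
      (integrable_bromwich hm hlam hν (hf j) hc x ht).const_mul _]
    congr 1 with w
    simp only [Finset.mul_sum]
    exact Finset.sum_congr rfl fun j _ => by ring
  rw [h, Complex.re_sum]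
  exact Finset.sum_congr rfl fun j _ => Complex.re_ofReal_mul _ _

/-- On symbols, the equation `∂_t = -∑ j, λ_j ∂_x ^ {ν_j}` is the definition of `Ψ`. -/
theorem bromwich_neg_mul (hm : 1 ≤ m) (hlam : ∀ j, 0 < lam j) (hν : ∀ j, ν j ∈ Ioo (0 : ℝ) 1)
    (hg : PolyGrowth g) (hc : 0 < c) (x : ℝ) {t : ℝ} (ht : 0 < t) :
    (bromwich lam ν c (fun z => -laplaceExponent lam ν z * g z) x t).re =
      -∑ j, lam j * (bromwich lam ν c (fun z => z ^ (ν j : ℂ) * g z) x t).re := by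
  rw [← bromwich_sum hm hlam hν lam (fun j => (PolyGrowth.cpow (ν j)).mul hg) hc x ht,
    ← Complex.neg_re]
  congr 1
  simp only [bromwich, ← integral_neg]
  congr 1 with w
  simp only [laplaceExponent, neg_mul, mul_neg, Finset.sum_mul, mul_assoc]

/-- Laplace transforms of a function given by Bromwich integrals on every vertical line may be
differentiated under the integral sign: for the exponent `μ`, use the line `Re z = μ / 2`. -/
theorem laplace_of_forall_eq_bromwich (hm : 1 ≤ m) (hlam : ∀ j, 0 < lam j)
    (hν : ∀ j, ν j ∈ Ioo (0 : ℝ) 1) (hg : PolyGrowth g) {F : ℝ → ℝ → ℝ}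
    (hF : ∀ c, 0 < c → ∀ x t, 0 < x → 0 < t → F x t = (bromwich lam ν c g x t).re)
    {t μ : ℝ} (ht : 0 < t) (hμ : 0 < μ) :
    IntegrableOn (fun x => Real.exp (-μ * x) * F x t) (Ioi 0) ∧
      IntegrableOn (fun x => Real.exp (-μ * x) * deriv (fun s => F x s) t) (Ioi 0) ∧
      HasDerivAt (fun s => ∫ x in Ioi (0 : ℝ), Real.exp (-μ * x) * F x s)
        (∫ x in Ioi (0 : ℝ), Real.exp (-μ * x) * deriv (fun s => F x s) t) t := by
  have hc : 0 < μ / 2 := half_pos hμ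
  have hg' : PolyGrowth fun z => -laplaceExponent lam ν z * g z :=
    (PolyGrowth.laplaceExponent lam ν).neg.mul hg
  set f : ℝ → ℝ → ℝ := fun s x => Real.exp (-μ * x) * (bromwich lam ν (μ / 2) g x s).re with hf
  set f' : ℝ → ℝ → ℝ := fun s x => Real.exp (-μ * x) *
    (bromwich lam ν (μ / 2) (fun z => -laplaceExponent lam ν z * g z) x s).re with hf'
  have hbound : ∀ {g₀ : ℂ → ℂ}, PolyGrowth g₀ → ∃ B, ∀ s, t / 2 ≤ s → ∀ x,
      ‖Real.exp (-μ * x) * (bromwich lam ν (μ / 2) g₀ x s).re‖ ≤ B * Real.exp (-(μ / 2) * x) := by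
    intro g₀ hg₀
    obtain ⟨B, hB⟩ := exists_norm_bromwich_le hm hlam hν hg₀ hc (half_pos ht)
    refine ⟨B, fun s hs x => ?_⟩
    rw [norm_mul, Real.norm_of_nonneg (Real.exp_nonneg _)]
    calc _ ≤ Real.exp (-μ * x) * (B * Real.exp (μ / 2 * x)) := by
          gcongr
          exact (Complex.abs_re_le_norm _).trans (hB s hs x)
      _ = B * Real.exp (-(μ / 2) * x) := by
          rw [mul_left_comm, ← Real.exp_add]; ring_nf
  have hei : IntegrableOn (fun x => Real.exp (-(μ / 2) * x)) (Ioi 0) :=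
    exp_neg_integrableOn_Ioi 0 hc
  have hmeas : ∀ {g₀ : ℂ → ℂ}, PolyGrowth g₀ → ∀ s, 0 < s → AEStronglyMeasurable
      (fun x => Real.exp (-μ * x) * (bromwich lam ν (μ / 2) g₀ x s).re)
      (volume.restrict (Ioi 0)) := fun hg₀ s hs => by
    have := continuous_bromwich_re hm hlam hν hg₀ hc hs
    exact Continuous.aestronglyMeasurable (by fun_prop)
  obtain ⟨B, hB⟩ := hbound hg
  obtain ⟨B', hB'⟩ := hbound hg'
  have hd : ∀ x s, 0 < s → HasDerivAt (fun s => (bromwich lam ν (μ / 2) g x s).re)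
      (bromwich lam ν (μ / 2) (fun z => -laplaceExponent lam ν z * g z) x s).re s :=
    fun x s hs => (hasDerivAt_bromwich_time hm hlam hν hg hc x hs).complex_re
  have e1 : ∀ s, 0 < s → EqOn (fun x => Real.exp (-μ * x) * F x s) (f s) (Ioi 0) :=
    fun s hs x hx => by simp only [hf, hF _ hc x s hx hs]
  have e2 : EqOn (fun x => Real.exp (-μ * x) * deriv (fun s => F x s) t) (f' t) (Ioi 0) := by
    intro x hx
    have : deriv (fun s => F x s) t =
        (bromwich lam ν (μ / 2) (fun z => -laplaceExponent lam ν z * g z) x t).re := by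
      refine ((hd x t ht).congr_of_eventuallyEq ?_).deriv
      filter_upwards [Ioi_mem_nhds ht] with s hs using hF _ hc x s hx hs
    simp only [hf', this]
  have hfi : IntegrableOn (f t) (Ioi 0) :=
    Integrable.mono' (hei.const_mul B) (hmeas hg t ht)
      (Eventually.of_forall fun x => hB t (half_le_self ht.le) x)
  have key := hasDerivAt_integral_of_dominated_loc_of_deriv_le (μ := volume.restrict (Ioi 0))
    (F := f) (F' := f') (Ioi_mem_nhds (half_lt_self ht))
    (by filter_upwards [Ioi_mem_nhds ht] with s hs using hmeas hg s hs) hfi (hmeas hg' t ht)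
    (Eventually.of_forall fun x s hs => hB' s (le_of_lt hs) x) (hei.const_mul B')
    (Eventually.of_forall fun x s hs =>
      (hd x s ((half_pos ht).trans hs)).const_mul _)
  refine ⟨(integrableOn_congr_fun (e1 t ht) measurableSet_Ioi).2 hfi,
    (integrableOn_congr_fun e2 measurableSet_Ioi).2 key.1, ?_⟩
  rw [setIntegral_congr_fun measurableSet_Ioi e2]
  refine key.2.congr_of_eventuallyEq ?_
  filter_upwards [Ioi_mem_nhds ht] with s hs
  exact setIntegral_congr_fun measurableSet_Ioi (e1 s hs)

theorem continuous_sumDensity (hm : 1 ≤ m) (hlam : ∀ j, 0 < lam j)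
    (hν : ∀ j, ν j ∈ Ioo (0 : ℝ) 1) {t : ℝ} (ht : 0 < t) :
    Continuous fun x => sumDensity lam ν x t :=
  continuous_bromwich_re hm hlam hν (PolyGrowth.const 1) one_pos ht

section

variable {ρ : Measure ℝ} {t : ℝ}

theorem IsSubordinatorLaw.sumDensity_nonneg (h : IsSubordinatorLaw lam ν t ρ) (hm : 1 ≤ m)
    (hlam : ∀ j, 0 < lam j) (hν : ∀ j, ν j ∈ Ioo (0 : ℝ) 1) (ht : 0 < t) (x : ℝ) :
    0 ≤ sumDensity lam ν x t :=
  (h.density hm hlam hν ht one_pos).1 x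

theorem IsSubordinatorLaw.eq_withDensity (h : IsSubordinatorLaw lam ν t ρ) (hm : 1 ≤ m)
    (hlam : ∀ j, 0 < lam j) (hν : ∀ j, ν j ∈ Ioo (0 : ℝ) 1) (ht : 0 < t) :
    ρ = (volume.restrict (Ioi 0)).withDensity fun x => ENNReal.ofReal (sumDensity lam ν x t) := by
  rw [← withDensity_indicator measurableSet_Ioi]
  refine (h.density hm hlam hν ht one_pos).2.trans ?_
  congr 1 with x
  by_cases hx : x ∈ Ioi (0 : ℝ)
  · rw [indicator_of_mem hx, sumDensity]
  · rw [indicator_of_notMem hx, h.bromwich_one_eq_zero hm hlam hν ht one_pos x (not_lt.1 hx),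
      ENNReal.ofReal_zero]

theorem IsSubordinatorLaw.integral_eq {E : Type*} [NormedAddCommGroup E] [NormedSpace ℝ E]
    (h : IsSubordinatorLaw lam ν t ρ) (hm : 1 ≤ m) (hlam : ∀ j, 0 < lam j)
    (hν : ∀ j, ν j ∈ Ioo (0 : ℝ) 1) (ht : 0 < t) (f : ℝ → E) :
    ∫ x, f x ∂ρ = ∫ x in Ioi (0 : ℝ), sumDensity lam ν x t • f x := by
  have hc := continuous_sumDensity hm hlam hν ht
  conv_lhs => rw [h.eq_withDensity hm hlam hν ht]
  rw [integral_withDensity_eq_integral_toReal_smul hc.measurable.ennreal_ofReal (by simp)]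
  congr 1 with x
  rw [ENNReal.toReal_ofReal (h.sumDensity_nonneg hm hlam hν ht x)]

theorem IsSubordinatorLaw.integrableOn_sumDensity (h : IsSubordinatorLaw lam ν t ρ) (hm : 1 ≤ m)
    (hlam : ∀ j, 0 < lam j) (hν : ∀ j, ν j ∈ Ioo (0 : ℝ) 1) (ht : 0 < t) :
    IntegrableOn (fun x => sumDensity lam ν x t) (Ioi 0) := by
  have hp := h.prob
  have hc := continuous_sumDensity hm hlam hν ht
  refine ⟨hc.aestronglyMeasurable, ?_⟩
  rw [hasFiniteIntegral_iff_ofReal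
    (Eventually.of_forall fun x => h.sumDensity_nonneg hm hlam hν ht x)]
  have h1 : ρ univ < ⊤ := measure_lt_top ρ univ
  rw [h.eq_withDensity hm hlam hν ht, withDensity_apply _ MeasurableSet.univ] at h1
  simpa using h1

theorem IsSubordinatorLaw.laplace_sumDensity (h : IsSubordinatorLaw lam ν t ρ) (hm : 1 ≤ m)
    (hlam : ∀ j, 0 < lam j) (hν : ∀ j, ν j ∈ Ioo (0 : ℝ) 1) (ht : 0 < t) {μ : ℝ} (hμ : 0 < μ) :
    ∫ x in Ioi (0 : ℝ), Real.exp (-μ * x) * sumDensity lam ν x t =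
      Real.exp (-t * ∑ j, lam j * μ ^ ν j) := by
  rw [← h.laplace μ hμ, h.integral_eq hm hlam hν ht]
  simp only [smul_eq_mul, mul_comm]

/-- The inverse Laplace transform of `(Ψ(z) / z) e^{-tΨ(z)}` is a combination of fractional
integrals of the density, on every vertical line. -/
theorem IsSubordinatorLaw.bromwich_inverse (h : IsSubordinatorLaw lam ν t ρ) (hm : 1 ≤ m)
    (hlam : ∀ j, 0 < lam j) (hν : ∀ j, ν j ∈ Ioo (0 : ℝ) 1) (ht : 0 < t) (hc : 0 < c) :
    (∀ x, 0 ≤ x → (bromwich lam ν c (laplaceExponent lam fun j => ν j - 1) x t).re =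
      ∑ j, lam j * fracIntegral (ν j) (fun y => sumDensity lam ν y t) x) ∧
    ∀ x ≤ 0, (bromwich lam ν c (laplaceExponent lam fun j => ν j - 1) x t).re = 0 := by
  have hz := h.bromwich_one_eq_zero hm hlam hν ht hc
  have h1 := fun j => fracIntegral_bromwich hm hlam hν (PolyGrowth.const 1) hc (hν j).2 ht hz
  have h2 : ∀ x, (bromwich lam ν c (laplaceExponent lam fun j => ν j - 1) x t).re =
      ∑ j, lam j * (bromwich lam ν c (fun z => z ^ ((ν j - 1 : ℝ) : ℂ) * 1) x t).re := fun x => by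
    rw [← bromwich_sum hm hlam hν lam
      (fun j => (PolyGrowth.cpow (ν j - 1)).mul (PolyGrowth.const 1)) hc x ht]
    simp only [mul_one]
    rfl
  constructor
  · intro x hx
    rw [h2]
    refine Finset.sum_congr rfl fun j _ => ?_
    rw [← (h1 j).1 x hx]
    simp only [sumDensity, h.bromwich_one_indep hm hlam hν ht hc one_pos]
  · intro x hx
    rw [h2]
    exact Finset.sum_eq_zero fun j _ => by rw [(h1 j).2 x hx, mul_zero]

end

/-! ### The problem for the density of the weighted sum -/

theorem solvesDensityProblem_sumDensity (hm : 1 ≤ m) (hlam : ∀ j, 0 < lam j)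
    (hν : ∀ j, ν j ∈ Ioo (0 : ℝ) 1) (hρ : IsSubordinatorFamily lam ν ρ) :
    SolvesDensityProblem lam ν (sumDensity lam ν) := by
  have hL := fun (t μ : ℝ) (ht : 0 < t) (hμ : 0 < μ) =>
    laplace_of_forall_eq_bromwich hm hlam hν (PolyGrowth.const 1) (F := sumDensity lam ν)
      (fun c hc x t hx ht => (hρ.law t ht).bromwich_one_indep hm hlam hν ht one_pos hc x) ht hμ
  refine ⟨fun t ht => (continuous_sumDensity hm hlam hν ht).continuousOn,
    fun t ht => (hρ.law t ht).integrableOn_sumDensity hm hlam hν ht, fun x t hx ht => ?_,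
    fun φ => ?_, fun t ht => (hρ.law t ht).bromwich_one_eq_zero hm hlam hν ht one_pos 0 le_rfl,
    fun t μ ht hμ => (hL t μ ht hμ).2.1, fun t μ ht hμ => (hL t μ ht hμ).2.2⟩
  · refine ⟨fun j => (bromwich lam ν 1 (fun z => z ^ (ν j : ℂ) * 1) x t).re, fun j => ?_, ?_⟩
    · exact hasRLDerivAt_bromwich hm hlam hν (PolyGrowth.const 1) one_pos (hν j).2 ht
        ((hρ.law t ht).bromwich_one_eq_zero hm hlam hν ht one_pos) hx
    · rw [← bromwich_neg_mul hm hlam hν (PolyGrowth.const 1) one_pos x ht]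
      exact (hasDerivAt_bromwich_time hm hlam hν (PolyGrowth.const 1) one_pos x ht).complex_re
  · refine (hρ.tendsto φ).congr' ?_
    filter_upwards [self_mem_nhdsWithin] with t ht
    rw [(hρ.law t ht).integral_eq hm hlam hν ht]
    simp only [smul_eq_mul, mul_comm]

/-- The Fourier transform is the limit of the Laplace transform as `Re z → 0`. -/
theorem IsSubordinatorLaw.fourier {ρ : Measure ℝ} {t : ℝ} (h : IsSubordinatorLaw lam ν t ρ)
    (hν : ∀ j, ν j ∈ Ioo (0 : ℝ) 1) (ξ : ℝ) :
    ∫ x, Complex.exp (Complex.I * ξ * x) ∂ρ =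
      Complex.exp (-t * laplaceExponent lam ν (-Complex.I * ξ)) := by
  have hp := h.prob
  have h1 : Tendsto (fun ε : ℝ => ∫ x, Complex.exp (-(ε + -Complex.I * ξ) * x) ∂ρ) (𝓝[>] 0)
      (𝓝 (∫ x, Complex.exp (Complex.I * ξ * x) ∂ρ)) := by
    refine tendsto_integral_filter_of_dominated_convergence (fun _ => 1)
      (Eventually.of_forall fun ε => by fun_prop) ?_ (integrable_const _)
      (Eventually.of_forall fun x => ?_)
    · filter_upwards [self_mem_nhdsWithin] with ε hε
      have hε : 0 < ε := hε
      filter_upwards [h.nonneg] with x hx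
      rw [Complex.norm_exp, Real.exp_le_one_iff]
      simp
      positivity
    · refine Tendsto.mono_left ?_ nhdsWithin_le_nhds
      exact (by fun_prop : Continuous fun ε : ℝ =>
        Complex.exp (-(ε + -Complex.I * ξ) * x)).tendsto' _ _ (by simp)
  have h2 : Tendsto (fun ε : ℝ => Complex.exp (-t * laplaceExponent lam ν (ε + -Complex.I * ξ)))
      (𝓝[>] 0) (𝓝 (Complex.exp (-t * laplaceExponent lam ν (-Complex.I * ξ)))) := by
    refine Tendsto.mono_left ?_ nhdsWithin_le_nhds
    refine (Complex.continuous_exp.tendsto _).comp (Tendsto.const_mul _ ?_)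
    refine tendsto_finsetSum _ fun j _ => Tendsto.const_mul _ ?_
    have h3 : ContinuousAt (fun z : ℂ => z ^ (ν j : ℂ)) (-Complex.I * ξ) :=
      Complex.continuousAt_cpow_const_of_re_pos (by simp) (by simpa using (hν j).1)
    exact h3.tendsto.comp ((by fun_prop : Continuous fun ε : ℝ => (ε : ℂ) + -Complex.I * ξ).tendsto'
      _ _ (by simp))
  refine tendsto_nhds_unique h1 (h2.congr' ?_)
  filter_upwards [self_mem_nhdsWithin] with ε hε
  have hε : 0 < ε := hε
  exact (h.laplace_complex (by simpa using hε)).symm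

end

/-! ### The boundary behaviour at small times -/

section

variable {m : ℕ} {lam ν : Fin m → ℝ} {ρ : ℝ → Measure ℝ}

/-- As `x → 0` the law with density `sumDensity · x` concentrates at `0`, so its fractional
integral at `t` tends to the kernel at `t`. The kernel `(t - s) ^ (-a)` is singular at `s = t`, but
near `t` the density is `O(x)`, so a continuous truncation suffices. -/
theorem IsSubordinatorFamily.tendsto_fracIntegral (hρ : IsSubordinatorFamily lam ν ρ) (hm : 1 ≤ m)
    (hlam : ∀ j, 0 < lam j) (hν : ∀ j, ν j ∈ Ioo (0 : ℝ) 1) {a : ℝ} (ha : a ∈ Ico (0 : ℝ) 1)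
    {t : ℝ} (ht : 0 < t) :
    Tendsto (fun x => fracIntegral a (fun y => sumDensity lam ν y x) t) (𝓝[>] 0)
      (𝓝 (t ^ (-a) / Real.Gamma (1 - a))) := by
  obtain ⟨C, hC⟩ := exists_sq_mul_norm_bromwich_le hm hlam hν
  -- `k * χ` is bounded and continuous, equals the kernel on `[0, t / 2]` and vanishes beyond `t`
  set k : ℝ → ℝ := fun s => (max (t - s) (t / 2)) ^ (-a) with hk
  set χ : ℝ → ℝ := fun s => min 1 (max 0 (2 * (t - s) / t)) with hχ
  have hχ0 : ∀ s, 0 ≤ χ s := fun s => le_min zero_le_one (le_max_left _ _)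
  have hχ1 : ∀ s, χ s ≤ 1 := fun s => min_le_left _ _
  have hk0 : ∀ s, 0 ≤ k s := fun s => Real.rpow_nonneg (by positivity) _
  have hcont : Continuous fun s => k s * χ s := by
    refine Continuous.mul ?_ (by fun_prop)
    refine Continuous.rpow_const (by fun_prop) fun s => Or.inl ?_
    have : 0 < max (t - s) (t / 2) := lt_max_of_lt_right (half_pos ht)
    exact this.ne'
  have hbd : ∀ s, ‖k s * χ s‖ ≤ (t / 2) ^ (-a) := fun s => by
    rw [Real.norm_of_nonneg (mul_nonneg (hk0 s) (hχ0 s))]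
    have : k s ≤ (t / 2) ^ (-a) :=
      Real.rpow_le_rpow_of_nonpos (half_pos ht) (le_max_right _ _) (by linarith [ha.1])
    calc k s * χ s ≤ k s * 1 := mul_le_mul_of_nonneg_left (hχ1 s) (hk0 s)
      _ ≤ _ := by rwa [mul_one]
  have h1 := hρ.tendsto (BoundedContinuousFunction.ofNormedAddCommGroup _ hcont _ hbd)
  have hφ0 : k 0 * χ 0 = t ^ (-a) := by
    have e1 : max (t - 0) (t / 2) = t := by rw [sub_zero, max_eq_left (half_le_self ht.le)]
    have e2 : 2 * (t - 0) / t = 2 := by field_simp; ring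
    simp only [hk, hχ, e1, e2]
    norm_num
  simp only [BoundedContinuousFunction.coe_ofNormedAddCommGroup, hφ0] at h1
  have hki : IntervalIntegrable (fun s : ℝ => (t - s) ^ (-a)) volume 0 t := by
    have := (intervalIntegral.intervalIntegrable_rpow' (a := t) (b := 0) (r := -a)
      (by linarith [ha.2])).comp_sub_left t
    simpa using this
  have hki' : IntegrableOn (fun s : ℝ => (t - s) ^ (-a)) (Ioc 0 t) :=
    (intervalIntegrable_iff_integrableOn_Ioc_of_le ht.le).1 hki
  set M : ℝ := ∫ s in Ioc 0 t, C * Real.exp t * (4 / t ^ 2) * (t - s) ^ (-a) with hM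
  have hdiff : ∀ s ∈ Ioc 0 t, |(t - s) ^ (-a) - k s * χ s| ≤
      if s ≤ t / 2 then 0 else (t - s) ^ (-a) := by
    intro s hs
    split_ifs with hst
    · have e1 : max (t - s) (t / 2) = t - s := max_eq_left (by linarith)
      have e2 : χ s = 1 := by
        refine min_eq_left (le_max_of_le_right ?_)
        rw [le_div_iff₀ ht]
        linarith
      simp [hk, e1, e2]
    · have hK : 0 ≤ (t - s) ^ (-a) := Real.rpow_nonneg (by linarith [hs.2]) _
      have hle : k s * χ s ≤ (t - s) ^ (-a) := by
        rcases hs.2.eq_or_lt with rfl | hlt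
        · have : χ s = 0 := by simp [hχ]
          rw [this, mul_zero]
          exact hK
        · calc k s * χ s ≤ k s * 1 := mul_le_mul_of_nonneg_left (hχ1 s) (hk0 s)
            _ ≤ (t - s) ^ (-a) := by
              rw [mul_one]
              exact Real.rpow_le_rpow_of_nonpos (sub_pos.2 hlt) (le_max_left _ _)
                (by linarith [ha.1])
      rw [abs_of_nonneg (sub_nonneg.2 hle)]
      linarith [mul_nonneg (hk0 s) (hχ0 s)]
  have hmain : ∀ x, 0 < x →
      |(∫ s in (0 : ℝ)..t, sumDensity lam ν s x / (t - s) ^ a) - ∫ s, k s * χ s ∂(ρ x)| ≤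
        x * M := by
    intro x hx
    have hc := continuous_sumDensity hm hlam hν hx
    have hn := (hρ.law x hx).sumDensity_nonneg hm hlam hν hx
    have e1 : ∫ s, k s * χ s ∂(ρ x) = ∫ s in Ioc 0 t, sumDensity lam ν s x * (k s * χ s) := by
      rw [(hρ.law x hx).integral_eq hm hlam hν hx]
      simp only [smul_eq_mul]
      refine setIntegral_eq_of_subset_of_forall_sdiff_eq_zero measurableSet_Ioi Ioc_subset_Ioi_self
        fun s hs => ?_
      have hst : t < s := not_le.1 fun h => hs.2 ⟨hs.1, h⟩
      have : χ s = 0 := by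
        have : 2 * (t - s) / t ≤ 0 := div_nonpos_of_nonpos_of_nonneg (by linarith) ht.le
        simp [hχ, max_eq_left this]
      rw [this, mul_zero, mul_zero]
    have e2 : ∫ s in (0 : ℝ)..t, sumDensity lam ν s x / (t - s) ^ a =
        ∫ s in Ioc 0 t, sumDensity lam ν s x * (t - s) ^ (-a) := by
      rw [intervalIntegral.integral_of_le ht.le]
      refine setIntegral_congr_fun measurableSet_Ioc fun s hs => ?_
      simp only [Real.rpow_neg (sub_nonneg.2 hs.2), div_eq_mul_inv]
    have i1 : IntegrableOn (fun s => sumDensity lam ν s x * (k s * χ s)) (Ioc 0 t) :=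
      (hc.mul hcont).integrableOn_Ioc
    have i2 : IntegrableOn (fun s => sumDensity lam ν s x * (t - s) ^ (-a)) (Ioc 0 t) :=
      (intervalIntegrable_iff_integrableOn_Ioc_of_le ht.le).1
        (hki.continuousOn_mul hc.continuousOn)
    rw [e1, e2, ← integral_sub i2 i1, hM, ← integral_const_mul, ← Real.norm_eq_abs]
    refine norm_integral_le_of_norm_le ((hki'.const_mul _).const_mul _) ?_
    filter_upwards [ae_restrict_mem measurableSet_Ioc] with s hs
    rw [← mul_sub, norm_mul, Real.norm_of_nonneg (hn s), Real.norm_eq_abs]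
    have hd := hdiff s hs
    have hK : 0 ≤ (t - s) ^ (-a) := Real.rpow_nonneg (by linarith [hs.2]) _
    have hCx : ∀ s, s ^ 2 * sumDensity lam ν s x ≤ C * x * Real.exp s := fun s =>
      (mul_le_mul_of_nonneg_left (Complex.re_le_norm _) (sq_nonneg s)).trans (hC x hx s)
    have hC0 : 0 ≤ C * x := by
      have := hCx 0
      simpa using this
    split_ifs at hd with hst
    · rw [le_antisymm hd (abs_nonneg _), mul_zero]
      have : 0 ≤ C * x * (Real.exp t * (4 / t ^ 2) * (t - s) ^ (-a)) := by positivity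
      linarith
    · have hst := not_le.1 hst
      have h4 : sumDensity lam ν s x ≤ C * x * Real.exp t * (4 / t ^ 2) := by
        have h5 : sumDensity lam ν s x * (t / 2) ^ 2 ≤ C * x * Real.exp t := by
          calc sumDensity lam ν s x * (t / 2) ^ 2 ≤ sumDensity lam ν s x * s ^ 2 := by
                have := hn s
                gcongr
            _ ≤ C * x * Real.exp s := by rw [mul_comm]; exact hCx s
            _ ≤ C * x * Real.exp t := by
                gcongr
                exact hs.2
        rw [mul_div_assoc', le_div_iff₀ (by positivity)]
        linarith
      calc sumDensity lam ν s x * |(t - s) ^ (-a) - k s * χ s|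
          ≤ (C * x * Real.exp t * (4 / t ^ 2)) * (t - s) ^ (-a) :=
            mul_le_mul h4 hd (abs_nonneg _) (by positivity)
        _ = _ := by ring
  have h2 : Tendsto (fun x => (∫ s in (0 : ℝ)..t, sumDensity lam ν s x / (t - s) ^ a) -
      ∫ s, k s * χ s ∂(ρ x)) (𝓝[>] 0) (𝓝 0) := by
    refine squeeze_zero_norm' (a := fun x => x * M) ?_ ?_
    · filter_upwards [self_mem_nhdsWithin] with x hx using hmain x hx
    · exact ((continuous_id.mul continuous_const).tendsto' 0 0 (by simp)).mono_left
        nhdsWithin_le_nhds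
  have h3 := (h2.add h1).const_mul (1 / Real.Gamma (1 - a))
  simp only [sub_add_cancel, zero_add] at h3
  rw [div_eq_mul_one_div, mul_comm]
  exact h3

/-! ### The problem for the density of the first-passage time -/

theorem inverseDensity_of_pos (lam ν : Fin m → ℝ) {x : ℝ} (hx : 0 < x) (t : ℝ) :
    inverseDensity lam ν x t = (bromwich lam ν 1 (laplaceExponent lam fun j => ν j - 1) t x).re :=
  if_pos hx

theorem inverseDensity_zero (lam ν : Fin m → ℝ) (t : ℝ) :
    inverseDensity lam ν 0 t = ∑ j, lam j * (t ^ (-ν j) / Real.Gamma (1 - ν j)) :=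
  if_neg (lt_irrefl 0)

theorem IsSubordinatorFamily.inverseDensity_eq (hρ : IsSubordinatorFamily lam ν ρ) (hm : 1 ≤ m)
    (hlam : ∀ j, 0 < lam j) (hν : ∀ j, ν j ∈ Ioo (0 : ℝ) 1) {x t : ℝ} (hx : 0 < x) (ht : 0 ≤ t) :
    inverseDensity lam ν x t =
      ∑ j, lam j * fracIntegral (ν j) (fun y => sumDensity lam ν y x) t := by
  rw [inverseDensity_of_pos lam ν hx]
  exact ((hρ.law x hx).bromwich_inverse hm hlam hν hx one_pos).1 t ht

theorem fracIntegral_nonneg {a : ℝ} (ha : a < 1) {f : ℝ → ℝ} (hf : ∀ y, 0 ≤ f y) {x : ℝ}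
    (hx : 0 ≤ x) : 0 ≤ fracIntegral a f x := by
  have hG : 0 < Real.Gamma (1 - a) := Real.Gamma_pos_of_pos (by linarith)
  refine mul_nonneg (by positivity) (intervalIntegral.integral_nonneg hx fun s hs => ?_)
  exact div_nonneg (hf s) (Real.rpow_nonneg (sub_nonneg.2 hs.2) _)

theorem IsSubordinatorFamily.inverseDensity_nonneg (hρ : IsSubordinatorFamily lam ν ρ)
    (hm : 1 ≤ m) (hlam : ∀ j, 0 < lam j) (hν : ∀ j, ν j ∈ Ioo (0 : ℝ) 1) {x t : ℝ} (hx : 0 < x)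
    (ht : 0 ≤ t) : 0 ≤ inverseDensity lam ν x t := by
  rw [hρ.inverseDensity_eq hm hlam hν hx ht]
  exact Finset.sum_nonneg fun j _ => mul_nonneg (hlam j).le
    (fracIntegral_nonneg (hν j).2 ((hρ.law x hx).sumDensity_nonneg hm hlam hν hx) ht)

theorem IsSubordinatorFamily.laplace_inverseDensity (hρ : IsSubordinatorFamily lam ν ρ)
    (hm : 1 ≤ m) (hlam : ∀ j, 0 < lam j) (hν : ∀ j, ν j ∈ Ioo (0 : ℝ) 1) {x μ : ℝ} (hx : 0 < x)
    (hμ : 0 < μ) : ∫ t in Ioi (0 : ℝ), Real.exp (-μ * t) * inverseDensity lam ν x t =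
      (∑ j, lam j * μ ^ (ν j - 1)) * Real.exp (-x * ∑ j, lam j * μ ^ ν j) := by
  have hi : IntegrableOn (fun y => Real.exp (-μ * y) * sumDensity lam ν y x) (Ioi 0) :=
    (laplace_of_forall_eq_bromwich hm hlam hν (PolyGrowth.const 1) (F := sumDensity lam ν)
      (fun c hc x t _ ht => (hρ.law t ht).bromwich_one_indep hm hlam hν ht one_pos hc x) hx hμ).1
  have e : EqOn (fun t => Real.exp (-μ * t) * inverseDensity lam ν x t) (fun t => ∑ j, lam j *
      (Real.exp (-μ * t) * fracIntegral (ν j) (fun y => sumDensity lam ν y x) t)) (Ioi 0) := by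
    intro t ht
    simp only [hρ.inverseDensity_eq hm hlam hν hx (le_of_lt ht), Finset.mul_sum]
    exact Finset.sum_congr rfl fun j _ => by ring
  rw [setIntegral_congr_fun measurableSet_Ioi e, integral_finsetSum _ fun j _ =>
    (laplace_fracIntegral (hν j).2 hμ hi).1.const_mul _, Finset.sum_mul]
  refine Finset.sum_congr rfl fun j _ => ?_
  rw [integral_const_mul, (laplace_fracIntegral (hν j).2 hμ hi).2,
    (hρ.law x hx).laplace_sumDensity hm hlam hν hx hμ, mul_assoc]

/-- With `Θ(z) = Ψ(z) / z`, each equation is an identity of symbols on the line `Re z = 1`; the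
boundary values come from `l(x, ·) = ∑ j, λ_j I ^ {1 - ν_j} h(·, x)`. -/
theorem solvesInverseProblem_inverseDensity (hm : 1 ≤ m) (hlam : ∀ j, 0 < lam j)
    (hν : ∀ j, ν j ∈ Ioo (0 : ℝ) 1) (hρ : IsSubordinatorFamily lam ν ρ) :
    SolvesInverseProblem lam ν (inverseDensity lam ν) := by
  have hΘ : PolyGrowth (laplaceExponent lam fun j => ν j - 1) := PolyGrowth.laplaceExponent _ _
  have hfun : ∀ x, 0 < x → (fun t => inverseDensity lam ν x t) = fun t =>
      (bromwich lam ν 1 (laplaceExponent lam fun j => ν j - 1) t x).re := fun x hx => by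
    funext t
    exact inverseDensity_of_pos lam ν hx t
  have hcont : ∀ x, 0 < x → Continuous fun t => inverseDensity lam ν x t := fun x hx => by
    rw [hfun x hx]
    exact continuous_bromwich_re hm hlam hν hΘ one_pos hx
  have hL := fun (x μ : ℝ) (hx : 0 < x) (hμ : 0 < μ) =>
    laplace_of_forall_eq_bromwich hm hlam hν hΘ (F := fun t x => inverseDensity lam ν x t)
      (fun c hc t x ht hx => by
        rw [hρ.inverseDensity_eq hm hlam hν hx ht.le,
          ((hρ.law x hx).bromwich_inverse hm hlam hν hx hc).1 t ht.le]) hx hμ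
  refine ⟨fun x hx => (hcont x hx).continuousOn, fun x t hx ht => ?_,
    fun t _ => inverseDensity_zero lam ν t, fun t ht => ?_,
    fun x hx j => tendsto_fracIntegral_zero (hν j) (hcont x hx).continuousOn,
    fun x μ hx hμ => ⟨(hL x μ hx hμ).1, (hL x μ hx hμ).2.1⟩,
    fun x μ hx hμ => (hL x μ hx hμ).2.2, fun μ hμ => ?_⟩
  · refine ⟨fun j => (bromwich lam ν 1
      (fun z => z ^ (ν j : ℂ) * laplaceExponent lam (fun j => ν j - 1) z) t x).re, fun j => ?_, ?_⟩
    · rw [hfun x hx]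
      exact hasRLDerivAt_bromwich hm hlam hν hΘ one_pos (hν j).2 hx
        ((hρ.law x hx).bromwich_inverse hm hlam hν hx one_pos).2 ht
    · rw [← bromwich_neg_mul hm hlam hν hΘ one_pos t hx]
      refine (hasDerivAt_bromwich_time hm hlam hν hΘ one_pos t hx).complex_re.congr_of_eventuallyEq
        ?_
      filter_upwards [Ioi_mem_nhds hx] with y hy using inverseDensity_of_pos lam ν hy t
  · rw [inverseDensity_zero]
    have h1 : Tendsto (fun x => ∑ j, lam j * fracIntegral (ν j) (fun y => sumDensity lam ν y x) t)
        (𝓝[>] 0) (𝓝 (∑ j, lam j * (t ^ (-ν j) / Real.Gamma (1 - ν j)))) :=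
      tendsto_finsetSum _ fun j _ => (hρ.tendsto_fracIntegral hm hlam hν
        ⟨(hν j).1.le, (hν j).2⟩ ht).const_mul _
    refine h1.congr' ?_
    filter_upwards [self_mem_nhdsWithin] with x hx
    exact (hρ.inverseDensity_eq hm hlam hν hx ht.le).symm
  · simp only [inverseDensity_zero]
    rw [laplace_boundary_value hν hμ]
    have h1 : Tendsto (fun x : ℝ => (∑ j, lam j * μ ^ (ν j - 1)) *
        Real.exp (-x * ∑ j, lam j * μ ^ ν j)) (𝓝[>] 0) (𝓝 (∑ j, lam j * μ ^ (ν j - 1))) := by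
      refine Tendsto.mono_left ?_ nhdsWithin_le_nhds
      exact (by fun_prop : Continuous fun x : ℝ => (∑ j, lam j * μ ^ (ν j - 1)) *
        Real.exp (-x * ∑ j, lam j * μ ^ ν j)).tendsto' _ _ (by simp)
    refine h1.congr' ?_
    filter_upwards [self_mem_nhdsWithin] with x hx
    exact (hρ.laplace_inverseDensity hm hlam hν hx hμ).symm

end

/-! ### The law of the first-passage time -/

section

variable {m : ℕ} {lam ν : Fin m → ℝ} {ρ : ℝ → Measure ℝ}

/-- `ρ x (-∞, t)`, the distribution function of the density, has `x`-derivative `-l(x, t)`. -/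
theorem IsSubordinatorFamily.hasDerivAt_fracIntegral_zero (hρ : IsSubordinatorFamily lam ν ρ)
    (hm : 1 ≤ m) (hlam : ∀ j, 0 < lam j) (hν : ∀ j, ν j ∈ Ioo (0 : ℝ) 1) {x t : ℝ} (hx : 0 < x)
    (ht : 0 < t) :
    HasDerivAt (fun s => fracIntegral 0 (fun y => sumDensity lam ν y s) t)
      (-inverseDensity lam ν x t) x := by
  have hg : PolyGrowth fun z => z ^ ((0 - 1 : ℝ) : ℂ) * 1 :=
    (PolyGrowth.cpow (0 - 1)).mul (PolyGrowth.const 1)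
  have h1 := (hasDerivAt_bromwich_time hm hlam hν hg one_pos t hx).complex_re
  have h2 : (bromwich lam ν 1 (fun z => -laplaceExponent lam ν z * (z ^ ((0 - 1 : ℝ) : ℂ) * 1))
      t x).re = -inverseDensity lam ν x t := by
    rw [inverseDensity_of_pos lam ν hx, bromwich_congr (c := 1)
      (g' := fun z => -laplaceExponent lam (fun j => ν j - 1) z) one_pos fun z hz => ?_]
    · rw [← Complex.neg_re]
      congr 1
      simp only [bromwich, ← integral_neg, mul_neg]
    · have hz0 : z ≠ 0 := Complex.slitPlane_ne_zero (mem_slitPlane_of_re_pos hz)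
      rw [laplaceExponent_eq_mul lam ν hz, zero_sub, Complex.ofReal_neg, Complex.ofReal_one,
        Complex.cpow_neg_one]
      field_simp
  rw [h2] at h1
  refine h1.congr_of_eventuallyEq ?_
  filter_upwards [Ioi_mem_nhds hx] with s hs
  exact (fracIntegral_bromwich hm hlam hν (PolyGrowth.const 1) one_pos one_pos hs
    ((hρ.law s hs).bromwich_one_eq_zero hm hlam hν hs one_pos)).1 t ht.le

theorem fracIntegral_zero_eq (f : ℝ → ℝ) (x : ℝ) :
    fracIntegral 0 f x = ∫ s in (0 : ℝ)..x, f s := by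
  simp [fracIntegral]

/-- The distribution function of the first-passage time: `∫_0^x l(s, t) ds = ρ x [t, ∞)`. -/
theorem IsSubordinatorFamily.lintegral_inverseDensity (hρ : IsSubordinatorFamily lam ν ρ)
    (hm : 1 ≤ m) (hlam : ∀ j, 0 < lam j) (hν : ∀ j, ν j ∈ Ioo (0 : ℝ) 1) {x t : ℝ} (hx : 0 < x)
    (ht : 0 < t) :
    ∫⁻ s in Ioc 0 x, ENNReal.ofReal (inverseDensity lam ν s t) = ρ x (Ici t) := by
  set G : ℝ → ℝ := fun s => fracIntegral 0 (fun y => sumDensity lam ν y s) t with hG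
  -- `G s → 1` as `s → 0+`, so `F` is the continuous extension of `-G` to `[0, x]`
  set F : ℝ → ℝ := fun s => if 0 < s then -G s else -1 with hF
  have hFd : ∀ s, 0 < s → HasDerivAt F (inverseDensity lam ν s t) s := fun s hs => by
    have := (hρ.hasDerivAt_fracIntegral_zero hm hlam hν hs ht).neg
    rw [neg_neg] at this
    refine this.congr_of_eventuallyEq ?_
    filter_upwards [Ioi_mem_nhds hs] with r hr using if_pos hr
  have hFc : ContinuousOn F (Icc 0 x) := by
    intro s hs
    rcases hs.1.eq_or_lt with rfl | hs0
    · have h1 := (hρ.tendsto_fracIntegral hm hlam hν ⟨le_rfl, one_pos⟩ ht).neg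
      simp only [neg_zero, Real.rpow_zero, sub_zero, Real.Gamma_one, div_one] at h1
      have h2 : ContinuousWithinAt F (Ioi 0) 0 := by
        rw [ContinuousWithinAt, show F 0 = -1 from if_neg (lt_irrefl 0)]
        refine h1.congr' ?_
        filter_upwards [self_mem_nhdsWithin] with r hr using (if_pos hr).symm
      exact (continuousWithinAt_Ioi_iff_Ici.1 h2).mono Icc_subset_Ici_self
    · exact (hFd s hs0).continuousAt.continuousWithinAt
  have hn : ∀ s, 0 < s → 0 ≤ inverseDensity lam ν s t := fun s hs =>
    hρ.inverseDensity_nonneg hm hlam hν hs ht.le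
  -- a nonnegative derivative of a continuous function is integrable
  have hint : IntegrableOn (fun s => inverseDensity lam ν s t) (Ioc 0 x) :=
    intervalIntegral.integrableOn_deriv_of_nonneg hFc (fun s hs => hFd s hs.1)
      fun s hs => hn s hs.1
  have hftc : ∫ s in Ioc 0 x, inverseDensity lam ν s t = 1 - G x := by
    rw [← intervalIntegral.integral_of_le hx.le,
      intervalIntegral.integral_eq_sub_of_hasDerivAt_of_le hx.le hFc (fun s hs => hFd s hs.1)
        ((intervalIntegrable_iff_integrableOn_Ioc_of_le hx.le).2 hint)]
    simp only [hF, hx, if_true, lt_irrefl, if_false]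
    ring
  have hlaw := hρ.law x hx
  have hp := hlaw.prob
  have hc := continuous_sumDensity hm hlam hν hx
  have hG' : ρ x (Iio t) = ENNReal.ofReal (G x) := by
    have e : Iio t ∩ Ioi 0 = Ioo 0 t := by
      ext y
      simp [and_comm]
    rw [hlaw.eq_withDensity hm hlam hν hx, withDensity_apply _ measurableSet_Iio,
      Measure.restrict_restrict measurableSet_Iio, e, restrict_Ioo_eq_restrict_Ioc,
      ← ofReal_integral_eq_lintegral_ofReal hc.integrableOn_Ioc
        (Eventually.of_forall (hlaw.sumDensity_nonneg hm hlam hν hx)),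
      ← intervalIntegral.integral_of_le ht.le]
    simp only [hG, fracIntegral_zero_eq]
  rw [← ofReal_integral_eq_lintegral_ofReal hint
    ((ae_restrict_mem measurableSet_Ioc).mono fun s hs => hn s hs.1), hftc, ← compl_Iio,
    prob_compl_eq_one_sub measurableSet_Iio, hG', ENNReal.ofReal_sub _
      (fracIntegral_nonneg one_pos (hlaw.sumDensity_nonneg hm hlam hν hx) ht.le),
    ENNReal.ofReal_one]

/-! ### The double Laplace transform -/

/-- Fubini's theorem, for the nonnegative integrand, and the transform of `l` in `t`. -/
theorem IsSubordinatorFamily.double_laplace (hρ : IsSubordinatorFamily lam ν ρ) (hm : 1 ≤ m)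
    (hlam : ∀ j, 0 < lam j) (hν : ∀ j, ν j ∈ Ioo (0 : ℝ) 1) {γ μ : ℝ} (hγ : 0 < γ) (hμ : 0 < μ) :
    ∫ t in Ioi (0 : ℝ), Real.exp (-μ * t) *
        ∫ x in Ioi (0 : ℝ), Real.exp (-γ * x) * inverseDensity lam ν x t =
      (∑ j, lam j * μ ^ (ν j - 1)) / (∑ j, lam j * μ ^ ν j + γ) := by
  have hS := solvesInverseProblem_inverseDensity hm hlam hν hρ
  set K := ∑ j, lam j * μ ^ (ν j - 1)
  set S := ∑ j, lam j * μ ^ ν j with hSdef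
  have hS0 : 0 ≤ S := Finset.sum_nonneg fun j _ => mul_nonneg (hlam j).le (Real.rpow_nonneg hμ.le _)
  set f : ℝ → ℝ → ℝ := fun t x =>
    Real.exp (-γ * x) * (Real.exp (-μ * t) * inverseDensity lam ν x t) with hf
  have hinner : ∀ x, 0 < x → ∫ t in Ioi (0 : ℝ), f t x = K * Real.exp (-(S + γ) * x) := by
    intro x hx
    simp only [hf]
    rw [integral_const_mul, hS.laplace_eq hν hx hμ, mul_left_comm, ← Real.exp_add]
    change K * Real.exp (-γ * x + -x * S) = _
    congr 2
    ring
  have hcont : ContinuousOn (Function.uncurry f) (Ioi 0 ×ˢ Ioi 0) := by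
    have h1 : ContinuousOn (fun p : ℝ × ℝ => inverseDensity lam ν p.2 p.1) (Ioi 0 ×ˢ Ioi 0) := by
      have h2 : ContinuousOn (fun p : ℝ × ℝ =>
          (bromwich lam ν 1 (laplaceExponent lam fun j => ν j - 1) p.1 p.2).re)
          (Ioi 0 ×ˢ Ioi 0) := fun p hp =>
        (Complex.continuous_re.continuousAt.comp (continuousAt_bromwich hm hlam hν
          (PolyGrowth.laplaceExponent _ _) one_pos (mem_prod.1 hp).2)).continuousWithinAt
      exact h2.congr fun p hp => inverseDensity_of_pos lam ν (mem_prod.1 hp).2 _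
    have h3 : Continuous fun p : ℝ × ℝ => Real.exp (-γ * p.2) := by fun_prop
    have h4 : Continuous fun p : ℝ × ℝ => Real.exp (-μ * p.1) := by fun_prop
    exact h3.continuousOn.mul (h4.continuousOn.mul h1)
  have hnorm : ∀ x, 0 < x → ∀ t, 0 < t → ‖f t x‖ = f t x := fun x hx t ht =>
    Real.norm_of_nonneg (mul_nonneg (Real.exp_nonneg _) (mul_nonneg (Real.exp_nonneg _)
      (hρ.inverseDensity_nonneg hm hlam hν hx (le_of_lt ht))))
  have hexp : IntegrableOn (fun x => K * Real.exp (-(S + γ) * x)) (Ioi 0) :=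
    (exp_neg_integrableOn_Ioi 0 (by linarith : 0 < S + γ)).const_mul K
  have hint : Integrable (Function.uncurry f)
      ((volume.restrict (Ioi 0)).prod (volume.restrict (Ioi 0))) := by
    have hmeas : AEStronglyMeasurable (Function.uncurry f)
        ((volume.restrict (Ioi 0)).prod (volume.restrict (Ioi 0))) := by
      rw [Measure.prod_restrict]
      exact hcont.aestronglyMeasurable (measurableSet_Ioi.prod measurableSet_Ioi)
    refine (integrable_prod_iff' hmeas).2 ⟨?_, ?_⟩
    · filter_upwards [ae_restrict_mem measurableSet_Ioi] with x hx
      exact (hS.laplace_integrable x μ hx hμ).1.const_mul (Real.exp (-γ * x))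
    · refine (integrableOn_congr_fun (fun x hx => ?_) measurableSet_Ioi).2 hexp
      rw [← hinner x hx]
      exact setIntegral_congr_fun measurableSet_Ioi fun t ht => hnorm x hx t ht
  calc _ = ∫ t in Ioi (0 : ℝ), ∫ x in Ioi (0 : ℝ), f t x := by
        congr 1 with t
        rw [← integral_const_mul]
        congr 1 with x
        simp only [hf]
        ring
    _ = ∫ x in Ioi (0 : ℝ), ∫ t in Ioi (0 : ℝ), f t x := integral_integral_swap hint
    _ = ∫ x in Ioi (0 : ℝ), K * Real.exp (-(S + γ) * x) :=
        setIntegral_congr_fun measurableSet_Ioi fun x hx => hinner x hx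
    _ = K / (S + γ) := by
        rw [integral_const_mul, integral_exp_mul_Ioi (by linarith), mul_zero, Real.exp_zero,
          neg_div_neg_eq, mul_one_div]

end

/-! ### Stable subordinators -/

section

variable {Ω : Type*} [MeasurableSpace Ω] {P : Measure Ω} {m : ℕ}
  {lam ν : Fin m → ℝ} {H : Fin m → ℝ≥0 → Ω → ℝ}

theorem isSubordinatorFamily_weightedSum [IsProbabilityMeasure P] (hlam : ∀ j, 0 < lam j)
    (hν : ∀ j, ν j ∈ Ioo (0 : ℝ) 1) (hH : ∀ j, IsStableSubordinator P (ν j) (H j))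
    (hindep : iIndepFun (fun j (ω : Ω) (t : ℝ≥0) => H j t ω) P) :
    IsSubordinatorFamily lam ν fun t => P.map (weightedSum lam ν H t.toNNReal) := by
  refine ⟨fun t ht => ?_, tendsto_integral_map_weightedSum hlam hH⟩
  have := isSubordinatorLaw_weightedSum hlam hν hH hindep t.toNNReal
  rwa [Real.coe_toNNReal t ht.le] at this

theorem hasHalfLineDensity_weightedSum [IsProbabilityMeasure P] (hm : 1 ≤ m)
    (hlam : ∀ j, 0 < lam j) (hν : ∀ j, ν j ∈ Ioo (0 : ℝ) 1)
    (hH : ∀ j, IsStableSubordinator P (ν j) (H j))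
    (hindep : iIndepFun (fun j (ω : Ω) (t : ℝ≥0) => H j t ω) P) {t : ℝ≥0} (ht : 0 < t) :
    HasHalfLineDensity P (weightedSum lam ν H t) fun x => sumDensity lam ν x t := by
  have h := isSubordinatorLaw_weightedSum hlam hν hH hindep t
  have ht : (0 : ℝ) < t := ht
  exact ⟨(measurable_weightedSum hH t).aemeasurable,
    fun x _ => h.sumDensity_nonneg hm hlam hν ht x, h.eq_withDensity hm hlam hν ht⟩

/-- `P(L(t) ≤ x) = P(H(x) ≥ t) = ∫_0^x l(s, t) ds`. -/
theorem hasHalfLineDensity_hittingTime [IsProbabilityMeasure P] (hm : 1 ≤ m)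
    (hlam : ∀ j, 0 < lam j) (hν : ∀ j, ν j ∈ Ioo (0 : ℝ) 1)
    (hH : ∀ j, IsStableSubordinator P (ν j) (H j))
    (hindep : iIndepFun (fun j (ω : Ω) (t : ℝ≥0) => H j t ω) P) {t : ℝ} (ht : 0 < t) :
    HasHalfLineDensity P (hittingTime (weightedSum lam ν H) t)
      fun x => inverseDensity lam ν x t := by
  have hρ := isSubordinatorFamily_weightedSum hlam hν hH hindep
  have hL := aemeasurable_hittingTime hm hlam hν hH hindep ht
  refine ⟨hL, fun x hx => hρ.inverseDensity_nonneg hm hlam hν hx ht.le, ?_⟩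
  have := Measure.isProbabilityMeasure_map hL
  refine Measure.ext_of_Iic _ _ fun x => ?_
  rw [withDensity_apply _ measurableSet_Iic, Measure.restrict_restrict measurableSet_Iic]
  rcases lt_or_ge 0 x with hx | hx
  · rw [map_hittingTime_Iic hm hlam hν hH hindep ht hx.le, Iic_inter_Ioi,
      hρ.lintegral_inverseDensity hm hlam hν hx ht]
  · have h0 : P.map (hittingTime (weightedSum lam ν H) t) (Iic 0) = 0 := by
      rw [map_hittingTime_Iic hm hlam hν hH hindep ht le_rfl, Real.toNNReal_zero,
        Measure.map_apply (measurable_weightedSum hH _) measurableSet_Ici]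
      refine measure_eq_zero_iff_ae_notMem.2 ?_
      filter_upwards [weightedSum_paths hlam hH] with ω hω
      simp [hω.1, ht]
    rw [measure_mono_null (Iic_subset_Iic.2 hx) h0, Iic_inter_Ioi, Ioc_eq_empty (not_lt.2 hx)]
    simp

end
theorem theorem2p1 {Ω : Type*} [MeasurableSpace Ω] (P : Measure Ω) [IsProbabilityMeasure P]
    (m : ℕ) (hm : 1 ≤ m) (lam ν : Fin m → ℝ) (hlam : ∀ j, 0 < lam j)
    (hν : ∀ j, ν j ∈ Ioo (0 : ℝ) 1) (H : Fin m → ℝ≥0 → Ω → ℝ)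
    (hH : ∀ j, IsStableSubordinator P (ν j) (H j))
    (hindep : iIndepFun (fun j (ω : Ω) (t : ℝ≥0) => H j t ω) P) :
    (∃ h : ℝ → ℝ → ℝ,
      (∀ t : ℝ≥0, 0 < t → HasHalfLineDensity P (weightedSum lam ν H t) (fun x => h x t)) ∧
      SolvesDensityProblem lam ν h ∧
      (∀ u, SolvesDensityProblem lam ν u → ∀ x t, 0 ≤ x → 0 < t → u x t = h x t) ∧
      (∀ t ξ : ℝ, 0 < t →
        ∫ x in Ioi (0 : ℝ), Complex.exp (Complex.I * ξ * x) * (h x t : ℂ) =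
          Complex.exp (-t * ∑ j, (lam j : ℂ) * (-Complex.I * ξ) ^ (ν j : ℂ)))) ∧
    (∃ l : ℝ → ℝ → ℝ,
      (∀ t : ℝ, 0 < t →
        HasHalfLineDensity P (hittingTime (weightedSum lam ν H) t) (fun x => l x t)) ∧
      SolvesInverseProblem lam ν l ∧
      (∀ u, SolvesInverseProblem lam ν u → ∀ x t, 0 ≤ x → 0 < t → u x t = l x t) ∧
      (∀ γ μ : ℝ, 0 < γ → 0 < μ →
        ∫ t in Ioi (0 : ℝ), Real.exp (-μ * t) * ∫ x in Ioi (0 : ℝ), Real.exp (-γ * x) * l x t =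
          (∑ j, lam j * μ ^ (ν j - 1)) / (∑ j, lam j * μ ^ ν j + γ))) := by
  have hρ := isSubordinatorFamily_weightedSum hlam hν hH hindep
  have hh := solvesDensityProblem_sumDensity hm hlam hν hρ
  have hl := solvesInverseProblem_inverseDensity hm hlam hν hρ
  refine ⟨⟨sumDensity lam ν,
      fun t ht => hasHalfLineDensity_weightedSum hm hlam hν hH hindep ht, hh,
      fun u hu x t hx ht => hu.eq hν hh hx ht, fun t ξ ht => ?_⟩,
    ⟨inverseDensity lam ν, fun t ht => hasHalfLineDensity_hittingTime hm hlam hν hH hindep ht, hl,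
      fun u hu x t hx ht => hu.eq hν hl hx ht,
      fun γ μ hγ hμ => hρ.double_laplace hm hlam hν hγ hμ⟩⟩
  rw [← laplaceExponent, ← (hρ.law t ht).fourier hν ξ, (hρ.law t ht).integral_eq hm hlam hν ht]
  congr 1 with x
  rw [Complex.real_smul, mul_comm]
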